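/- Let $c>0$, let $n\ge 1$, and let $\mu_1,\dots,\mu_n$ be positive Borel measures on $[0,\infty)$ (the spectral measures $d\mu_j(\Delta)=\rho_j(\Delta)\,d\Delta$ of $n$ sectors; for a discrete spectrum, $\mu_j$ is the sum of the Dirac masses at the scaling dimensions of the states of sector $j$), such that $\int e^{-\beta\Delta}\,d\mu_j(\Delta)<\infty$ for every $\beta>0$. For $\operatorname{Re}s>0$ let $Z_j(s)=\int e^{-s(\Delta-c/12)}\,d\mu_j(\Delta)$ be the partition function of sector $j$ and $\mathbf Z=(Z_1,\dots,Z_n)^T$. Assume that there is a constant complex $n\times n$ matrix $\mathbf F$ with $\mathbf F^2=\mathbf I$ and $$\mathbf Z\!\left(\frac{4\pi^2}{\beta+it}\right)=\mathbf F\cdot\mathbf Z(\beta+it)\qquad\text{for all }\beta>0,\ t\in\mathbb R,$$ and that the $\Delta=0$ state is nondegenerate and appears only in the first sector: $\mu_1(\{0\})=1$ and $\mu_j(\{0\})=0$ for $j\neq 1$. Put $$\rho_0(\Delta)=\left(\frac{c}{48\Delta^3}\right)^{1/4}\exp\!\left[2\pi\sqrt{\frac{c\Delta}{3}}\right].$$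 Then for every sector $j$ and every fixed $\delta>0$, the entry $\mathbf F_{j1}$ is real and, with $c_\pm=1\pm\frac{1}{2\delta}$, asymptotically as $\Delta\to\infty$, $$c_-\,\rho_0(\Delta)\,\mathbf F_{j1}\ \lesssim\ \frac{1}{2\delta}\int_{\Delta-\delta}^{\Delta+\delta}\rho_j(\Delta')\,d\Delta'\ \lesssim\ c_+\,\rho_0(\Delta)\,\mathbf F_{j1},$$ where the middle term is $\frac1{2\delta}\mu_j([\Delta-\delta,\Delta+\delta])$ and the inequalities hold up to $o(\rho_0(\Delta))$: for every $\varepsilon>0$ and all sufficiently large $\Delta$, $$(c_-\mathbf F_{j1}-\varepsilon)\,\rho_0(\Delta)\ \le\ \frac{1}{2\delta}\,\mu_j([\Delta-\delta,\Delta+\delta])\ \le\ (c_+\mathbf F_{j1}+\varepsilon)\,\rho_0(\Delta).$$ -/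

import Mathlib

open MeasureTheory Filter

noncomputable section

namespace VVMF

/-- The Cardy density `ρ₀(Δ) = (c / (48 Δ³))^{1/4} exp (2π √(cΔ/3))`. -/
def rhoZero (c Δ : ℝ) : ℝ :=
  (c / (48 * Δ ^ 3)) ^ (1 / 4 : ℝ) * Real.exp (2 * Real.pi * Real.sqrt (c * Δ / 3))

/-- `μ` is the spectral measure (`dF = ρ(Δ) dΔ`) of a sector: a positive measure on the scaling
dimensions `Δ ≥ 0` for which the partition function converges at every temperature.  For a
discrete spectrum, `μ` is the sum of the Dirac masses at the dimensions of the states. -/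
structure IsSpectralMeasure (μ : Measure ℝ) : Prop where
  nonneg : μ (Set.Iio 0) = 0
  integrable : ∀ β : ℝ, 0 < β → Integrable (fun x : ℝ => Real.exp (-β * x)) μ

/-- The partition function `Z(s) = ∫ exp (-s (Δ - c/12)) dμ(Δ)`, meant for `Re s > 0`. -/
def partitionFunction (c : ℝ) (μ : Measure ℝ) (s : ℂ) : ℂ :=
  ∫ x : ℝ, Complex.exp (-s * ((x : ℂ) - (c : ℂ) / 12)) ∂μ

/-- The sector partition functions form a vector valued modular function with constant
`S`-matrix `F`:  `Z(4π² / (β + it)) = F · Z(β + it)` for all `β > 0`, `t ∈ ℝ`, and `F² = 1`. -/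
structure IsVectorValuedModular {N : ℕ} (c : ℝ) (F : Matrix (Fin (N + 1)) (Fin (N + 1)) ℂ)
    (μ : Fin (N + 1) → Measure ℝ) : Prop where
  sq_eq_one : F * F = 1
  modular : ∀ β t : ℝ, 0 < β →
    (fun j => partitionFunction c (μ j) (4 * (Real.pi : ℂ) ^ 2 / ((β : ℂ) + (t : ℂ) * Complex.I)))
      = F.mulVec (fun j => partitionFunction c (μ j) ((β : ℂ) + (t : ℂ) * Complex.I))

/-- The (nondegenerate) state with `Δ = 0` lies in the first sector, and in no other one. -/
structure VacuumInFirstSector {N : ℕ} (μ : Fin (N + 1) → Measure ℝ) : Prop where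
  first : μ 0 {0} = 1
  other : ∀ j, j ≠ 0 → μ j {0} = 0

/-- The window average `(1 / 2δ) ∫_{Δ-δ}^{Δ+δ} ρ(Δ') dΔ'` over the closed window. -/
def windowAverage (μ : Measure ℝ) (δ Δ : ℝ) : ℝ :=
  1 / (2 * δ) * μ.real (Set.Icc (Δ - δ) (Δ + δ))

end VVMF

end

noncomputable section

namespace VVMF

open Real Set Topology

/-! ### The Beurling–Selberg functions -/

/-! The window average is squeezed between integrals of band-limited functions. If the Fourier
transform of `φ` lives in `[-Λ, Λ]`, then integrating `exp (-βx) φ(x - D)` against the measure of a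
sector involves its partition function only on `β + iτ`, `0 ≤ τ ≤ Λ`
(`integral_exp_mul_cosTransform`). The saddle point choice is `β = b²`, `D = π²c/(3b⁴)`, and the
modular relation writes `Z_j(s)` as `∑ F_jk Z_k(4π²/s)`.

For `τ ≤ β`, put `τ = b³v`: the dual temperature goes to zero, only the vacuum survives, and the
integrand tends to the entry of `F` times a Gaussian, with a Gaussian dominating it
(`tendsto_integral_saddle`). For `β ≤ τ ≤ Λ`, the dual partition functions are bounded by their
values at two real points. One gives half of the saddle exponent; the other, after a second modular
transformation, gives `exp (cΛ²/(12β))`, which is negligible against `exp (π²c/(3β))` because `Λ <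
2π` (`exists_norm_le_tail`).

Hence the smeared density is asymptotic to the entry of `F` times `ρ₀` times the integral of `φ`
(`tendsto_smeared`). Selberg's majorant and minorant of the window with band limit `2πl` have
integrals `2δ ± 1/l`. Across the window `exp (-βx)` varies by a factor tending to 1, so positivity
of the measure gives both bounds for `l < 1`, and `l → 1` gives `c±`. -/

/-- The Fejér kernel `(sin πy / πy)²`. -/
def fejer (y : ℝ) : ℝ := sinc (π * y) ^ 2

/-- The continuous positive function with `sin πt = t (1 - t) κ(t)` on `[0, 1]`. -/
def sinQuot (t : ℝ) : ℝ := π * (sinc (π * t) + sinc (π * (1 - t)))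

lemma mul_sinc (x : ℝ) : x * sinc x = sin x := by
  rcases eq_or_ne x 0 with rfl | h
  · simp
  · rw [sinc_of_ne_zero h]; field_simp

/-- The two terms contribute `(1 - t) sin πt` and `t sin π(1 - t)`, and the sines agree. Dividing by
`sinQuot` instead of `sin πt` removes the singularities at both endpoints. -/
lemma sinQuot_mul (t : ℝ) : t * (1 - t) * sinQuot t = sin (π * t) := by
  have h1 := mul_sinc (π * t)
  have h2 := mul_sinc (π * (1 - t))
  have h3 : sin (π * (1 - t)) = sin (π * t) := by
    rw [mul_sub, mul_one, sin_pi_sub]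
  rw [h3] at h2
  unfold sinQuot
  linear_combination (1 - t) * h1 + t * h2

lemma sinc_nonneg_of_mem {x : ℝ} (h : x ∈ Icc 0 π) : 0 ≤ sinc x := by
  rcases eq_or_ne x 0 with rfl | h0
  · simp
  · rw [sinc_of_ne_zero h0]
    exact div_nonneg (sin_nonneg_of_nonneg_of_le_pi h.1 h.2) h.1

lemma sinQuot_pos {t : ℝ} (ht : t ∈ Icc (0 : ℝ) 1) : 0 < sinQuot t := by
  have hp := pi_pos
  have h1 : 0 ≤ sinc (π * t) :=
    sinc_nonneg_of_mem ⟨by have := ht.1; positivity, by nlinarith [ht.2]⟩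
  have h2 : 0 ≤ sinc (π * (1 - t)) :=
    sinc_nonneg_of_mem ⟨by have := sub_nonneg.2 ht.2; positivity, by nlinarith [ht.1]⟩
  unfold sinQuot
  rcases eq_or_lt_of_le ht.2 with h | h
  · subst h; simp only [sub_self, mul_zero, sinc_zero]; nlinarith
  · rcases eq_or_lt_of_le ht.1 with h' | h'
    · subst h'; simp only [mul_zero, sinc_zero]; nlinarith
    · have : 0 < sinc (π * t) := by
        rw [sinc_of_ne_zero (by positivity)]
        exact div_pos (sin_pos_of_pos_of_lt_pi (by positivity) (by nlinarith)) (by positivity)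
      nlinarith

lemma continuous_sinQuot : Continuous sinQuot := by
  unfold sinQuot
  have := continuous_sinc
  fun_prop

lemma sinQuot_zero : sinQuot 0 = π := by
  have : sinc π = 0 := by rw [sinc_of_ne_zero pi_ne_zero]; simp
  simp [sinQuot, this]

lemma integral_one_sub : 2 * ∫ t in (0 : ℝ)..1, (1 - t) = 1 := by
  rw [intervalIntegral.integral_sub (by simp) (by simp)]
  simp
  norm_num

lemma integral_fejer (y : ℝ) : 2 * ∫ t in (0 : ℝ)..1, (1 - t) * cos (2 * π * t * y) = fejer y := by
  rcases eq_or_ne y 0 with rfl | hy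
  · simpa [fejer] using integral_one_sub
  · have hp := pi_ne_zero
    have key : ∀ t : ℝ, HasDerivAt
        (fun t => (1 - t) * sin (2 * π * t * y) / (2 * π * y) - cos (2 * π * t * y) / (2 * π * y) ^ 2)
        ((1 - t) * cos (2 * π * t * y)) t := by
      intro t
      have h0 : HasDerivAt (fun t : ℝ => 2 * π * t * y) (2 * π * y) t := by
        simpa using ((hasDerivAt_id t).const_mul (2 * π)).mul_const y
      have h1 := ((((hasDerivAt_id t).const_sub 1).mul h0.sin).div_const (2 * π * y)).sub
        (h0.cos.div_const ((2 * π * y) ^ 2))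
      refine h1.congr_deriv ?_
      simp only [id]
      field_simp
      ring
    rw [intervalIntegral.integral_eq_sub_of_hasDerivAt (fun t _ => key t)
      ((by fun_prop : Continuous fun t : ℝ => (1 - t) * cos (2 * π * t * y)).intervalIntegrable _ _)]
    have h2 : cos (2 * π * 1 * y) = 1 - 2 * sin (π * y) ^ 2 := by
      rw [show 2 * π * 1 * y = 2 * (π * y) by ring, cos_two_mul, ← sin_sq_add_cos_sq (π * y)]; ring
    rw [h2, fejer, sinc_of_ne_zero (by positivity)]
    simp
    field_simp
    ring

lemma fejer_of_ne_zero {y : ℝ} (hy : y ≠ 0) : fejer y = sin (π * y) ^ 2 / π ^ 2 * (1 / y ^ 2) := by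
  have hp := pi_ne_zero
  rw [fejer, sinc_of_ne_zero (by positivity)]
  field_simp

lemma fejer_zero : fejer 0 = 1 := by simp [fejer]

lemma fejer_neg (y : ℝ) : fejer (-y) = fejer y := by simp [fejer]

lemma fejer_natCast_succ (n : ℕ) : fejer ((n : ℝ) + 1) = 0 := by
  rw [fejer_of_ne_zero (by positivity)]
  have : sin (π * ((n : ℝ) + 1)) = 0 := by
    have := sin_nat_mul_pi (n + 1)
    rw [mul_comm]; exact_mod_cast this
  simp [this]

lemma fejer_add_natCast_succ {y : ℝ} (hy : 0 < y) (n : ℕ) :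
    fejer (y + (n + 1)) = sin (π * y) ^ 2 / π ^ 2 * (1 / (y + (n + 1)) ^ 2) := by
  rw [fejer_of_ne_zero (by positivity)]
  have : sin (π * (y + (n + 1))) ^ 2 = sin (π * y) ^ 2 := by
    have := sin_add_nat_mul_pi (π * y) (n + 1)
    rw [show π * (y + ((n : ℝ) + 1)) = π * y + ((n + 1 : ℕ) : ℝ) * π by push_cast; ring, this,
      mul_pow, ← pow_mul, mul_comm (n + 1) 2, pow_mul]
    simp
  rw [this]

/-- The continuous extension of `(1 - t) sin (2πty) / sin πt` to `[0, 1]`. -/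
def conjQuot (y t : ℝ) : ℝ := 2 * π * y * sinc (2 * π * t * y) / sinQuot t

lemma continuousOn_conjQuot (y : ℝ) : ContinuousOn (conjQuot y) (Icc 0 1) := by
  unfold conjQuot
  have := continuous_sinc
  refine ContinuousOn.div (by fun_prop) continuous_sinQuot.continuousOn
    fun t ht => (sinQuot_pos ht).ne'

lemma conjQuot_mul_sin (y : ℝ) {t : ℝ} (ht : t ∈ Icc (0 : ℝ) 1) :
    conjQuot y t * sin (π * t) = (1 - t) * sin (2 * π * t * y) := by
  have h := (sinQuot_pos ht).ne'
  rw [← sinQuot_mul, conjQuot, ← mul_sinc (2 * π * t * y)]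
  field_simp

/-- The continuous extension of `2 (1 - t) sin² (πty) / sin πt` to `[0, 1]`. -/
def sqQuot (y t : ℝ) : ℝ := 2 * sin (π * t * y) * (π * y * sinc (π * t * y)) / sinQuot t

lemma continuousOn_sqQuot (y : ℝ) : ContinuousOn (sqQuot y) (Icc 0 1) := by
  unfold sqQuot
  have := continuous_sinc
  refine ContinuousOn.div (by fun_prop) continuous_sinQuot.continuousOn
    fun t ht => (sinQuot_pos ht).ne'

lemma sqQuot_mul_sin (y : ℝ) {t : ℝ} (ht : t ∈ Icc (0 : ℝ) 1) :
    sqQuot y t * sin (π * t) = (1 - t) * (1 - cos (2 * π * t * y)) := by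
  have h := (sinQuot_pos ht).ne'
  have h2 : cos (2 * π * t * y) = 1 - 2 * sin (π * t * y) ^ 2 := by
    rw [show 2 * π * t * y = 2 * (π * t * y) by ring, cos_two_mul,
      ← sin_sq_add_cos_sq (π * t * y)]; ring
  have h3 := mul_sinc (π * t * y)
  rw [← sinQuot_mul, sqQuot, h2]
  field_simp
  linear_combination 2 * (1 - t) * sin (π * t * y) * h3

/-- Beurling's odd function `H`. -/
def beurling (y : ℝ) : ℝ :=
  2 * ∫ t in (0 : ℝ)..1, (conjQuot y t * cos (π * t) + sin (2 * π * t * y) / π)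

lemma uIcc_zero_one : uIcc (0 : ℝ) 1 = Icc 0 1 := uIcc_of_le zero_le_one

lemma intervalIntegrable_conjQuot_mul (y : ℝ) {f : ℝ → ℝ} (hf : Continuous f) :
    IntervalIntegrable (fun t => conjQuot y t * f t) volume 0 1 :=
  ContinuousOn.intervalIntegrable
    (by rw [uIcc_zero_one]; exact (continuousOn_conjQuot y).mul hf.continuousOn)

lemma intervalIntegrable_sqQuot_mul (y : ℝ) {f : ℝ → ℝ} (hf : Continuous f) :
    IntervalIntegrable (fun t => sqQuot y t * f t) volume 0 1 :=
  ContinuousOn.intervalIntegrable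
    (by rw [uIcc_zero_one]; exact (continuousOn_sqQuot y).mul hf.continuousOn)

lemma intervalIntegrable_fejer_integrand (y : ℝ) :
    IntervalIntegrable (fun t : ℝ => (1 - t) * cos (2 * π * t * y)) volume 0 1 :=
  (by fun_prop : Continuous fun t : ℝ => (1 - t) * cos (2 * π * t * y)).intervalIntegrable _ _

/-- Telescoping: `cos ((2N+1)πt) - cos ((2N+3)πt)` contains a factor `sin πt`, which cancels the
denominator of `conjQuot` and leaves the transforms of two translated Fejér kernels. -/
lemma conjQuot_partial_sum (y : ℝ) (N : ℕ) :
    2 * ∫ t in (0 : ℝ)..1, conjQuot y t * cos (π * t) =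
      ∑ n ∈ Finset.range N, (fejer (y - (n + 1)) - fejer (y + (n + 1))) +
      2 * ∫ t in (0 : ℝ)..1, conjQuot y t * cos ((2 * N + 1) * π * t) := by
  induction N with
  | zero => simp
  | succ N ih =>
    rw [ih, Finset.sum_range_succ, add_assoc]
    congr 1
    rw [← integral_fejer, ← integral_fejer, ← mul_sub, ← mul_add,
      ← intervalIntegral.integral_sub (intervalIntegrable_fejer_integrand _) (intervalIntegrable_fejer_integrand _),
      ← intervalIntegral.integral_add ((intervalIntegrable_fejer_integrand _).sub
        (intervalIntegrable_fejer_integrand _)) (intervalIntegrable_conjQuot_mul y (by fun_prop))]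
    congr 1
    refine intervalIntegral.integral_congr fun t ht => ?_
    rw [uIcc_zero_one] at ht
    have h := conjQuot_mul_sin y ht
    have e1 : cos ((2 * N + 1) * π * t) - cos ((2 * (N + 1 : ℕ) + 1) * π * t) =
        2 * sin (2 * π * t * (N + 1)) * sin (π * t) := by
      rw [show (2 * (N : ℝ) + 1) * π * t = 2 * π * t * (N + 1) - π * t by ring,
        show (2 * ((N + 1 : ℕ) : ℝ) + 1) * π * t = 2 * π * t * (N + 1) + π * t by push_cast; ring,
        cos_sub, cos_add]; ring
    have e2 : cos (2 * π * t * (y - (N + 1))) - cos (2 * π * t * (y + (N + 1))) =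
        2 * sin (2 * π * t * y) * sin (2 * π * t * (N + 1)) := by
      rw [mul_sub (2 * π * t), mul_add (2 * π * t) y, cos_sub, cos_add]; ring
    linear_combination conjQuot y t * e1 - (1 - t) * e2 + 2 * sin (2 * π * t * (N + 1)) * h

/-- The integer translates of the Fejér kernel sum to 1; this is that partition of unity with its
remainder made explicit, by the same telescoping. -/
lemma sqQuot_partial_sum (y : ℝ) (N : ℕ) :
    fejer y + ∑ n ∈ Finset.range N, (fejer (y - (n + 1)) + fejer (y + (n + 1))) =
      1 - 2 * ∫ t in (0 : ℝ)..1, sqQuot y t * sin ((2 * N + 1) * π * t) := by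
  induction N with
  | zero =>
    have h1 : ∫ t in (0 : ℝ)..1, sqQuot y t * sin ((2 * (0 : ℕ) + 1) * π * t) =
        ∫ t in (0 : ℝ)..1, ((1 - t) - (1 - t) * cos (2 * π * t * y)) := by
      refine intervalIntegral.integral_congr fun t ht => ?_
      rw [uIcc_zero_one] at ht
      have := sqQuot_mul_sin y ht
      simp only [Nat.cast_zero, mul_zero, zero_add, one_mul]
      linear_combination this
    rw [h1, intervalIntegral.integral_sub ((by fun_prop : Continuous fun t : ℝ => 1 - t).intervalIntegrable _ _)
      (intervalIntegrable_fejer_integrand _), mul_sub, integral_fejer, integral_one_sub]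
    ring
  | succ N ih =>
    rw [Finset.sum_range_succ, ← add_assoc, ih, sub_add, sub_right_inj, ← integral_fejer,
      ← integral_fejer]
    -- The Fejér kernel vanishes at nonzero integers, so the extra term `2 (1 - t) cos (2πt(N+1))`
    -- in the integrand below costs nothing.
    have hN := integral_fejer ((N : ℝ) + 1)
    rw [fejer_natCast_succ] at hN
    have e : ∀ t ∈ uIcc (0 : ℝ) 1, sqQuot y t * sin ((2 * (N + 1 : ℕ) + 1) * π * t) =
        sqQuot y t * sin ((2 * N + 1) * π * t) + 2 * ((1 - t) * cos (2 * π * t * (N + 1))) -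
        ((1 - t) * cos (2 * π * t * (y - (N + 1))) + (1 - t) * cos (2 * π * t * (y + (N + 1)))) := by
      intro t ht
      rw [uIcc_zero_one] at ht
      have h := sqQuot_mul_sin y ht
      have e1 : sin ((2 * (N + 1 : ℕ) + 1) * π * t) - sin ((2 * N + 1) * π * t) =
          2 * cos (2 * π * t * (N + 1)) * sin (π * t) := by
        rw [show (2 * (N : ℝ) + 1) * π * t = 2 * π * t * (N + 1) - π * t by ring,
          show (2 * ((N + 1 : ℕ) : ℝ) + 1) * π * t = 2 * π * t * (N + 1) + π * t by push_cast; ring,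
          sin_sub, sin_add]; ring
      have e2 : cos (2 * π * t * (y - (N + 1))) + cos (2 * π * t * (y + (N + 1))) =
          2 * cos (2 * π * t * y) * cos (2 * π * t * (N + 1)) := by
        rw [mul_sub (2 * π * t), mul_add (2 * π * t) y, cos_sub, cos_add]; ring
      linear_combination sqQuot y t * e1 + (1 - t) * e2 + 2 * cos (2 * π * t * (N + 1)) * h
    rw [intervalIntegral.integral_congr e, intervalIntegral.integral_sub, intervalIntegral.integral_add, intervalIntegral.integral_add, intervalIntegral.integral_const_mul]
    · linarith
    all_goals first
      | exact intervalIntegrable_fejer_integrand _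
      | exact (intervalIntegrable_fejer_integrand _).const_mul 2
      | exact intervalIntegrable_sqQuot_mul y (by fun_prop)
      | exact (intervalIntegrable_fejer_integrand _).add (intervalIntegrable_fejer_integrand _)
      | exact (intervalIntegrable_sqQuot_mul y (by fun_prop)).add
          ((intervalIntegrable_fejer_integrand _).const_mul 2)

/-! ### Riemann–Lebesgue limits and Beurling's inequality -/

/-- Riemann–Lebesgue at the frequencies `N + 1/2`. No regularity of `f` is asked: if it is not
integrable on `(0, 1]`, every integral is 0 by convention. -/
lemma tendsto_integral_mul_cexp (f : ℝ → ℝ) :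
    Tendsto (fun N : ℕ => ∫ t in (0 : ℝ)..1,
      (f t : ℂ) * Complex.exp (-((2 * N + 1) * π * t : ℝ) * Complex.I)) atTop (𝓝 0) := by
  have h := Real.tendsto_integral_exp_smul_cocompact
    (indicator (Ioc (0 : ℝ) 1) fun t => (f t : ℂ))
  have hw : Tendsto (fun N : ℕ => (N : ℝ) + 1 / 2) atTop (cocompact ℝ) :=
    (tendsto_atTop_add_const_right _ _ tendsto_natCast_atTop_atTop).mono_right atTop_le_cocompact
  refine (h.comp hw).congr fun N => ?_
  rw [intervalIntegral.integral_of_le zero_le_one, ← MeasureTheory.integral_indicator measurableSet_Ioc]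
  simp only [Function.comp]
  congr 1
  ext t
  by_cases ht : t ∈ Ioc (0 : ℝ) 1
  · simp only [indicator_of_mem ht, Circle.smul_def, Real.fourierChar_apply, smul_eq_mul]
    rw [mul_comm]
    congr 2
    push_cast
    ring
  · simp [indicator_of_notMem ht]

lemma tendsto_integral_mul_cos {f : ℝ → ℝ} (hf : ContinuousOn f (Icc 0 1)) :
    Tendsto (fun N : ℕ => ∫ t in (0 : ℝ)..1, f t * cos ((2 * N + 1) * π * t)) atTop (𝓝 0) := by
  have h := (Complex.continuous_re.tendsto _).comp (tendsto_integral_mul_cexp f)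
  refine h.congr fun N => ?_
  simp only [Function.comp]
  have hi : IntervalIntegrable (fun t : ℝ => (f t : ℂ) *
      Complex.exp (-((2 * N + 1) * π * t : ℝ) * Complex.I)) volume 0 1 := by
    refine ContinuousOn.intervalIntegrable ?_
    rw [uIcc_zero_one]
    exact (Complex.continuous_ofReal.comp_continuousOn hf).mul (by fun_prop)
  have := Complex.reCLM.intervalIntegral_comp_comm hi
  simp only [Complex.reCLM_apply] at this
  rw [← this]
  refine intervalIntegral.integral_congr fun t _ => ?_
  simp only [Complex.re_ofReal_mul]
  rw [← Complex.ofReal_neg, Complex.exp_ofReal_mul_I_re, cos_neg]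

lemma tendsto_integral_mul_sin {f : ℝ → ℝ} (hf : ContinuousOn f (Icc 0 1)) :
    Tendsto (fun N : ℕ => ∫ t in (0 : ℝ)..1, f t * sin ((2 * N + 1) * π * t)) atTop (𝓝 0) := by
  have h := ((Complex.continuous_im.tendsto _).comp (tendsto_integral_mul_cexp f)).neg
  simp only [Complex.zero_im, neg_zero] at h
  refine h.congr fun N => ?_
  simp only [Function.comp]
  have hi : IntervalIntegrable (fun t : ℝ => (f t : ℂ) *
      Complex.exp (-((2 * N + 1) * π * t : ℝ) * Complex.I)) volume 0 1 := by
    refine ContinuousOn.intervalIntegrable ?_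
    rw [uIcc_zero_one]
    exact (Complex.continuous_ofReal.comp_continuousOn hf).mul (by fun_prop)
  have := Complex.imCLM.intervalIntegral_comp_comm hi
  simp only [Complex.imCLM_apply] at this
  rw [← this, ← intervalIntegral.integral_neg]
  refine intervalIntegral.integral_congr fun t _ => ?_
  simp only [Complex.im_ofReal_mul]
  rw [← Complex.ofReal_neg, Complex.exp_ofReal_mul_I_im, sin_neg]
  ring

lemma integral_sin_two_pi_mul {y : ℝ} (hy : y ≠ 0) :
    2 * ∫ t in (0 : ℝ)..1, sin (2 * π * t * y) / π = sin (π * y) ^ 2 / π ^ 2 * (2 / y) := by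
  have hp := pi_ne_zero
  have key : ∀ t : ℝ, HasDerivAt (fun t => - cos (2 * π * t * y) / (2 * π * y) / π)
      (sin (2 * π * t * y) / π) t := by
    intro t
    have h0 : HasDerivAt (fun t : ℝ => 2 * π * t * y) (2 * π * y) t := by
      simpa using ((hasDerivAt_id t).const_mul (2 * π)).mul_const y
    refine ((h0.cos.neg.div_const (2 * π * y)).div_const π).congr_deriv ?_
    field_simp
  rw [intervalIntegral.integral_eq_sub_of_hasDerivAt (fun t _ => key t)
      ((by fun_prop : Continuous fun t : ℝ => sin (2 * π * t * y) / π).intervalIntegrable _ _)]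
  have h2 : cos (2 * π * 1 * y) = 1 - 2 * sin (π * y) ^ 2 := by
    rw [show 2 * π * 1 * y = 2 * (π * y) by ring, cos_two_mul, ← sin_sq_add_cos_sq (π * y)]; ring
  rw [h2]
  simp
  field_simp
  ring

/-- Subtracting the series of `H` from the partition of unity cancels the translates `fejer (y - n)`
and doubles the `fejer (y + n)`, all of which share the factor `sin² πy / π²`. -/
lemma tendsto_one_sub_beurling {y : ℝ} (hy : 0 < y) :
    Tendsto (fun N : ℕ => sin (π * y) ^ 2 / π ^ 2 * (1 / y ^ 2 +
      2 * ∑ n ∈ Finset.range N, 1 / (y + (n + 1)) ^ 2 - 2 / y)) atTop (𝓝 (1 - beurling y)) := by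
  have h1 := (tendsto_integral_mul_cos (continuousOn_conjQuot y)).const_mul 2
  have h2 := (tendsto_integral_mul_sin (continuousOn_sqQuot y)).const_mul 2
  have h3 := ((tendsto_const_nhds (x := 1 - beurling y)).add h1).sub h2
  simp only [mul_zero, add_zero, sub_zero] at h3
  refine h3.congr fun N => ?_
  have e1 := conjQuot_partial_sum y N
  have e2 := sqQuot_partial_sum y N
  have e3 : beurling y = 2 * (∫ t in (0 : ℝ)..1, conjQuot y t * cos (π * t)) +
      sin (π * y) ^ 2 / π ^ 2 * (2 / y) := by
    rw [← integral_sin_two_pi_mul hy.ne', ← mul_add, beurling, intervalIntegral.integral_add]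
    · exact intervalIntegrable_conjQuot_mul y (by fun_prop)
    · exact (by fun_prop : Continuous fun t : ℝ => sin (2 * π * t * y) / π).intervalIntegrable _ _
  rw [Finset.sum_sub_distrib] at e1
  rw [Finset.sum_add_distrib, fejer_of_ne_zero hy.ne'] at e2
  have e4 : ∑ n ∈ Finset.range N, fejer (y + (n + 1)) =
      sin (π * y) ^ 2 / π ^ 2 * ∑ n ∈ Finset.range N, 1 / (y + ((n : ℝ) + 1)) ^ 2 := by
    rw [Finset.mul_sum]
    exact Finset.sum_congr rfl fun n _ => fejer_add_natCast_succ hy n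
  rw [e4] at e1 e2
  rw [mul_sub, mul_add]
  linear_combination -e1 - e2 - e3

lemma sum_inv_sq_le {y : ℝ} (hy : 0 < y) (N : ℕ) :
    ∑ n ∈ Finset.range N, 1 / (y + ((n : ℝ) + 1)) ^ 2 ≤ 1 / y - 1 / (y + N) := by
  induction N with
  | zero => simp
  | succ N ih =>
    rw [Finset.sum_range_succ]
    have hN : (0 : ℝ) ≤ N := N.cast_nonneg
    have : 1 / (y + ((N : ℝ) + 1)) ^ 2 ≤ 1 / (y + N) - 1 / (y + (N + 1)) := by
      rw [div_sub_div _ _ (by positivity) (by positivity), div_le_div_iff₀ (by positivity) (by positivity)]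
      nlinarith
    push_cast
    linarith

lemma le_sum_inv_sq {y : ℝ} (hy : 0 < y) (N : ℕ) :
    1 / (y + 1) - 1 / (y + 1 + N) ≤ ∑ n ∈ Finset.range N, 1 / (y + ((n : ℝ) + 1)) ^ 2 := by
  induction N with
  | zero => simp
  | succ N ih =>
    rw [Finset.sum_range_succ]
    have hN : (0 : ℝ) ≤ N := N.cast_nonneg
    have : 1 / (y + 1 + N) - 1 / (y + 1 + (N + 1)) ≤ 1 / (y + ((N : ℝ) + 1)) ^ 2 := by
      rw [div_sub_div _ _ (by positivity) (by positivity), div_le_div_iff₀ (by positivity) (by positivity)]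
      nlinarith
    push_cast
    linarith

/-- Beurling's inequality: up to the common factor, `1/y² + 2 ∑ 1/(y+n)² - 2/y` must lie in `[-1/y²,
1/y²]`. Telescoping puts the series between `1/(y+1) ≥ 1/y - 1/y²` and `1/y`. -/
lemma abs_one_sub_beurling_le {y : ℝ} (hy : 0 < y) : |1 - beurling y| ≤ fejer y := by
  have h := tendsto_one_sub_beurling hy
  rw [fejer_of_ne_zero hy.ne', abs_le]
  have hs : 0 ≤ sin (π * y) ^ 2 / π ^ 2 := by positivity
  constructor
  · have h0 : Tendsto (fun N : ℕ => 1 / (y + 1 + N)) atTop (𝓝 0) := by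
      simp only [one_div]
      exact (tendsto_atTop_add_const_left _ _ tendsto_natCast_atTop_atTop).inv_tendsto_atTop
    have h1 := ((h0.const_mul 2).const_sub (-(1 / y ^ 2))).const_mul (sin (π * y) ^ 2 / π ^ 2)
    simp only [mul_zero, sub_zero, mul_neg] at h1
    refine le_of_tendsto_of_tendsto' h1 h fun N => ?_
    refine mul_le_mul_of_nonneg_left ?_ hs
    have h2 := le_sum_inv_sq hy N
    have h3 : 1 / y - 1 / y ^ 2 ≤ 1 / (y + 1) := by
      rw [div_sub_div _ _ (by positivity) (by positivity), div_le_div_iff₀ (by positivity) (by positivity)]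
      nlinarith
    have h4 : 2 / y = 2 * (1 / y) := by ring
    linarith
  · refine le_of_tendsto' h fun N => mul_le_mul_of_nonneg_left ?_ hs
    have h2 := sum_inv_sq_le hy N
    have h3 : 0 ≤ 1 / (y + N) := by positivity
    have h4 : 2 / y = 2 * (1 / y) := by ring
    linarith

lemma beurling_neg (y : ℝ) : beurling (-y) = -beurling y := by
  unfold beurling
  rw [← mul_neg, ← intervalIntegral.integral_neg]
  congr 1
  refine intervalIntegral.integral_congr fun t _ => ?_
  simp only [conjQuot, mul_neg, sin_neg, sinc_neg]
  ring

lemma beurling_zero : beurling 0 = 0 := by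
  have := beurling_neg 0
  rw [neg_zero] at this
  linarith

lemma one_le_beurling_add_fejer {y : ℝ} (hy : 0 ≤ y) : 1 ≤ beurling y + fejer y := by
  rcases hy.eq_or_lt with rfl | h
  · simp [beurling_zero, fejer_zero]
  · linarith [(abs_le.1 (abs_one_sub_beurling_le h)).2]

lemma beurling_sub_fejer_le_one (y : ℝ) : beurling y - fejer y ≤ 1 := by
  rcases lt_trichotomy y 0 with h | rfl | h
  · have h1 := (abs_le.1 (abs_one_sub_beurling_le (neg_pos.2 h))).2
    rw [beurling_neg, fejer_neg] at h1
    linarith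
  · simp [beurling_zero, fejer_zero]
  · linarith [(abs_le.1 (abs_one_sub_beurling_le h)).1]

lemma neg_one_le_beurling_add_fejer (y : ℝ) : -1 ≤ beurling y + fejer y := by
  have := beurling_sub_fejer_le_one (-y)
  rw [beurling_neg, fejer_neg] at this
  linarith

lemma beurling_sub_fejer_le_neg_one {y : ℝ} (hy : y ≤ 0) : beurling y - fejer y ≤ -1 := by
  have := one_le_beurling_add_fejer (neg_nonneg.2 hy)
  rw [beurling_neg, fejer_neg] at this
  linarith

/-! ### Selberg's majorant and minorant of an interval -/

/-- The cosine transform of Selberg's majorant (`σ = 1`) and minorant (`σ = -1`) of the indicator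
function of `[-d, d]`. -/
def selbergHat (σ d t : ℝ) : ℝ :=
  conjQuot d t * cos (π * t) + sin (2 * π * t * d) / π + σ * ((1 - t) * cos (2 * π * t * d))

lemma continuousOn_selbergHat (σ d : ℝ) : ContinuousOn (selbergHat σ d) (Icc 0 1) := by
  unfold selbergHat
  exact (((continuousOn_conjQuot d).mul (by fun_prop)).add (by fun_prop)).add (by fun_prop)

lemma selbergHat_zero (σ d : ℝ) : selbergHat σ d 0 = 2 * d + σ := by
  have := pi_ne_zero
  simp [selbergHat, conjQuot, sinQuot_zero]
  field_simp

/-- By the addition formulas, averaging over the arguments `d + u` and `d - u` leaves only the part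
even in `u`, where `cos (2πtu)` factors out. -/
lemma integral_selbergHat (σ d u : ℝ) :
    2 * ∫ t in (0 : ℝ)..1, selbergHat σ d t * cos (2 * π * t * u) =
      (beurling (u + d) + σ * fejer (u + d) + (beurling (d - u) + σ * fejer (d - u))) / 2 := by
  have i1 : ∀ y, IntervalIntegrable
      (fun t => conjQuot y t * cos (π * t) + sin (2 * π * t * y) / π) volume 0 1 := fun y =>
    (intervalIntegrable_conjQuot_mul y (by fun_prop)).add
      ((by fun_prop : Continuous fun t : ℝ => sin (2 * π * t * y) / π).intervalIntegrable _ _)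
  have i2 : ∀ y, IntervalIntegrable
      (fun t => conjQuot y t * cos (π * t) + sin (2 * π * t * y) / π +
        σ * ((1 - t) * cos (2 * π * t * y))) volume 0 1 := fun y =>
    (i1 y).add ((intervalIntegrable_fejer_integrand y).const_mul σ)
  have i3 : ∀ y, beurling y + σ * fejer y = 2 * ∫ t in (0 : ℝ)..1,
      (conjQuot y t * cos (π * t) + sin (2 * π * t * y) / π +
        σ * ((1 - t) * cos (2 * π * t * y))) := fun y => by
    rw [intervalIntegral.integral_add (i1 y) ((intervalIntegrable_fejer_integrand y).const_mul σ),
      intervalIntegral.integral_const_mul, ← integral_fejer, beurling]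
    ring
  rw [i3, i3, ← mul_add, ← intervalIntegral.integral_add (i2 _) (i2 _), mul_div_assoc, ← intervalIntegral.integral_div]
  congr 1
  -- At `t = 0` the explicit quotient for `conjQuot` would read `0 / 0`, so that point is discarded.
  have hae : ∀ᵐ t : ℝ, t ≠ 0 := by simp [ae_iff]
  refine intervalIntegral.integral_congr_ae (hae.mono fun t ht0 ht => ?_)
  rw [uIoc_of_le zero_le_one] at ht
  have hk := (sinQuot_pos ⟨ht.1.le, ht.2⟩).ne'
  have hq : ∀ y, conjQuot y t = sin (2 * π * t * y) / (t * sinQuot t) := fun y => by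
    rw [conjQuot, ← mul_sinc (2 * π * t * y)]
    field_simp
  simp only [selbergHat, hq, mul_add, mul_sub, sin_add, sin_sub, cos_add, cos_sub]
  ring

/-- `H + K` is at least `-1` everywhere and at least 1 on `[0, ∞)`. Inside the interval both `u + d`
and `d - u` are nonnegative; outside, one of them still is. -/
lemma indicator_le_integral_selbergHat {d : ℝ} (hd : 0 < d) (u : ℝ) :
    indicator (Icc (-d) d) 1 u ≤ 2 * ∫ t in (0 : ℝ)..1, selbergHat 1 d t * cos (2 * π * t * u) := by
  rw [integral_selbergHat]
  by_cases hu : u ∈ Icc (-d) d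
  · rw [indicator_of_mem hu, Pi.one_apply]
    have h1 := one_le_beurling_add_fejer (y := u + d) (by linarith [hu.1])
    have h2 := one_le_beurling_add_fejer (y := d - u) (by linarith [hu.2])
    linarith
  · rw [indicator_of_notMem hu]
    rcases le_or_gt 0 u with h | h
    · have h1 := one_le_beurling_add_fejer (y := u + d) (by linarith)
      have h2 := neg_one_le_beurling_add_fejer (d - u)
      linarith
    · have h1 := neg_one_le_beurling_add_fejer (u + d)
      have h2 := one_le_beurling_add_fejer (y := d - u) (by linarith)
      linarith

lemma integral_selbergHat_le_indicator (d u : ℝ) :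
    2 * ∫ t in (0 : ℝ)..1, selbergHat (-1) d t * cos (2 * π * t * u) ≤
      indicator (Icc (-d) d) 1 u := by
  rw [integral_selbergHat]
  have h1 := beurling_sub_fejer_le_one (u + d)
  have h2 := beurling_sub_fejer_le_one (d - u)
  by_cases hu : u ∈ Icc (-d) d
  · rw [indicator_of_mem hu, Pi.one_apply]
    linarith
  · rw [indicator_of_notMem hu]
    by_cases h : u < -d
    · have h3 := beurling_sub_fejer_le_neg_one (y := u + d) (by linarith)
      linarith
    · have h4 : d < u := by
        by_contra h'
        exact hu ⟨not_lt.1 h, not_lt.1 h'⟩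
      have h3 := beurling_sub_fejer_le_neg_one (y := d - u) (by linarith)
      linarith

/-! ### Laplace transforms of spectral measures -/

/-- The Laplace transform `∫ exp (-s x) dμ(x)`. -/
def laplace (μ : Measure ℝ) (s : ℂ) : ℂ := ∫ x : ℝ, Complex.exp (-s * x) ∂μ

lemma partitionFunction_eq (c : ℝ) (μ : Measure ℝ) (s : ℂ) :
    partitionFunction c μ s = Complex.exp (s * (c / 12)) * laplace μ s := by
  rw [partitionFunction, laplace, ← integral_const_mul]
  congr 1
  ext x
  rw [← Complex.exp_add]
  congr 1
  ring

namespace IsSpectralMeasure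

variable {μ : Measure ℝ}

lemma ae_nonneg (h : IsSpectralMeasure μ) : ∀ᵐ x ∂μ, 0 ≤ x := by
  rw [ae_iff]
  convert h.nonneg using 2
  ext x
  simp

lemma norm_cexp (s : ℂ) (x : ℝ) : ‖Complex.exp (-s * x)‖ = exp (-s.re * x) := by
  rw [Complex.norm_exp]
  simp

/-- Every `x > 0` is exponentially suppressed whatever the imaginary part of `s`, and `exp (-x)`
dominates; only the atom at 0 remains. -/
lemma tendsto_laplace (h : IsSpectralMeasure μ) {ι : Type*} {l : Filter ι}
    [l.IsCountablyGenerated] {s : ι → ℂ} (hs : Tendsto (fun i => (s i).re) l atTop) :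
    Tendsto (fun i => laplace μ (s i)) l (𝓝 (μ.real {0})) := by
  have e : (μ.real {0} : ℂ) = ∫ x : ℝ, indicator {0} (fun _ => (1 : ℂ)) x ∂μ := by
    rw [integral_indicator_const _ (measurableSet_singleton 0)]
    simp
  rw [e]
  refine tendsto_integral_filter_of_dominated_convergence (fun x => exp (-1 * x))
    (Eventually.of_forall fun i => by fun_prop) ?_ (h.integrable 1 one_pos) ?_
  · filter_upwards [hs.eventually_ge_atTop 1] with i hi
    filter_upwards [h.ae_nonneg] with x hx
    rw [norm_cexp]
    gcongr
  · filter_upwards [h.ae_nonneg] with x hx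
    rcases hx.eq_or_lt with rfl | hx
    · simpa using tendsto_const_nhds
    · rw [indicator_of_notMem (by simpa using hx.ne'), tendsto_zero_iff_norm_tendsto_zero]
      simp_rw [norm_cexp]
      refine tendsto_exp_atBot.comp ?_
      simp_rw [neg_mul]
      exact tendsto_neg_atTop_atBot.comp (hs.atTop_mul_const hx)

/-- Markov's inequality for the integrable function `exp (-x)`. This is what makes Fubini and finite
window masses available. -/
lemma isFiniteMeasureOnCompacts (h : IsSpectralMeasure μ) : IsFiniteMeasureOnCompacts μ := by
  refine ⟨fun K hK => ?_⟩
  obtain ⟨M, hM⟩ := hK.bddAbove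
  have h1 := (h.integrable 1 one_pos).measure_norm_ge_lt_top (ε := exp (-M)) (exp_pos _)
  refine (measure_mono fun x hx => ?_).trans_lt h1
  simp only [mem_ofPred_eq, norm_eq_abs, abs_exp]
  gcongr
  linarith [hM hx]

lemma integrable_exp_sub (h : IsSpectralMeasure μ) {u : ℝ} (hu : 0 < u) (a : ℝ) :
    Integrable (fun x : ℝ => exp (-u * (x - a))) μ := by
  refine ((h.integrable u hu).const_mul (exp (u * a))).congr (Eventually.of_forall fun x => ?_)
  simp only
  rw [← exp_add]
  congr 1
  ring

lemma norm_cexp_sub (s : ℂ) (x c : ℝ) :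
    ‖Complex.exp (-s * ((x : ℂ) - (c : ℂ) / 12))‖ = exp (-s.re * (x - c / 12)) := by
  rw [Complex.norm_exp, show (x : ℂ) - (c : ℂ) / 12 = ((x - c / 12 : ℝ) : ℂ) by push_cast; ring,
    Complex.re_mul_ofReal, Complex.neg_re]

lemma integrable_cexp_sub (h : IsSpectralMeasure μ) (c : ℝ) {s : ℂ} (hs : 0 < s.re) :
    Integrable (fun x : ℝ => Complex.exp (-s * ((x : ℂ) - (c : ℂ) / 12))) μ := by
  rw [← integrable_norm_iff (by fun_prop)]
  simp_rw [norm_cexp_sub]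
  exact h.integrable_exp_sub hs _

lemma norm_partitionFunction_le (h : IsSpectralMeasure μ) (c : ℝ) {s : ℂ} (hs : 0 < s.re) :
    ‖partitionFunction c μ s‖ ≤ ∫ x : ℝ, exp (-s.re * (x - c / 12)) ∂μ :=
  norm_integral_le_of_norm_le (h.integrable_exp_sub hs _)
    (Eventually.of_forall fun x => (norm_cexp_sub s x c).le)

lemma partitionFunction_ofReal (c : ℝ) (μ : Measure ℝ) (u : ℝ) :
    partitionFunction c μ u = ((∫ x : ℝ, exp (-u * (x - c / 12)) ∂μ : ℝ) : ℂ) := by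
  rw [partitionFunction, ← integral_complex_ofReal]
  congr 1
  ext x
  push_cast
  rfl

/-- For fixed `x` the integrand is monotone in `u`, in a direction set by the sign of `x - a`, so
one endpoint always dominates it. -/
lemma integral_exp_le_add (h : IsSpectralMeasure μ) (a : ℝ) {u u₁ u₂ : ℝ} (h0 : 0 < u₁)
    (h1 : u₁ ≤ u) (h2 : u ≤ u₂) :
    ∫ x : ℝ, exp (-u * (x - a)) ∂μ ≤
      (∫ x : ℝ, exp (-u₁ * (x - a)) ∂μ) + ∫ x : ℝ, exp (-u₂ * (x - a)) ∂μ := by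
  rw [← integral_add (h.integrable_exp_sub h0 a)
    (h.integrable_exp_sub (h0.trans_le (h1.trans h2)) a)]
  refine integral_mono (h.integrable_exp_sub (h0.trans_le h1) a)
    ((h.integrable_exp_sub h0 a).add (h.integrable_exp_sub (h0.trans_le (h1.trans h2)) a))
    fun x => ?_
  rcases le_total 0 (x - a) with hx | hx
  · have : exp (-u * (x - a)) ≤ exp (-u₁ * (x - a)) := exp_le_exp.2 (by nlinarith)
    linarith [exp_pos (-u₂ * (x - a))]
  · have : exp (-u * (x - a)) ≤ exp (-u₂ * (x - a)) := exp_le_exp.2 (by nlinarith)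
    linarith [exp_pos (-u₁ * (x - a))]

lemma integral_exp_sub_le (h : IsSpectralMeasure μ) (c : ℝ) {u : ℝ} (hu : 1 ≤ u) :
    ∫ x : ℝ, exp (-u * (x - c / 12)) ∂μ ≤ exp (u * (c / 12)) * ∫ x : ℝ, exp (-1 * x) ∂μ := by
  rw [← integral_const_mul]
  refine integral_mono_ae (h.integrable_exp_sub (by linarith) _)
    ((h.integrable 1 one_pos).const_mul _) ?_
  filter_upwards [h.ae_nonneg] with x hx
  rw [← exp_add]
  gcongr
  nlinarith

lemma continuous_partitionFunction (h : IsSpectralMeasure μ) (c : ℝ) {β : ℝ} (hβ : 0 < β) :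
    Continuous fun τ : ℝ => partitionFunction c μ ((β : ℂ) + (τ : ℂ) * Complex.I) := by
  unfold partitionFunction
  refine continuous_of_dominated (bound := fun x => exp (-β * (x - c / 12))) (fun τ => by fun_prop)
    (fun τ => Eventually.of_forall fun x => ?_) (h.integrable_exp_sub hβ _)
    (Eventually.of_forall fun x => by fun_prop)
  rw [norm_cexp_sub]
  simp

lemma integrable_prod_exp_mul_cos (h : IsSpectralMeasure μ) (a : ℝ) {β : ℝ} (hβ : 0 < β)
    (D : ℝ) {Λ : ℝ} {ψ : ℝ → ℝ} (hψ : ContinuousOn ψ (Icc 0 Λ)) :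
    Integrable (fun p : ℝ × ℝ => exp (-β * (p.1 - a)) * (ψ p.2 * cos (p.2 * (p.1 - D))))
      (μ.prod (volume.restrict (Ioc 0 Λ))) := by
  have := h.isFiniteMeasureOnCompacts
  have h1 : Integrable (fun p : ℝ × ℝ => exp (-β * (p.1 - a)) * ψ p.2)
      (μ.prod (volume.restrict (Ioc 0 Λ))) :=
    (h.integrable_exp_sub hβ _).mul_prod
      ((hψ.integrableOn_compact isCompact_Icc).mono_set Ioc_subset_Icc_self)
  refine (h1.mul_bdd (c := 1) (g := fun p : ℝ × ℝ => cos (p.2 * (p.1 - D))) (by fun_prop)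
    (Eventually.of_forall fun p => abs_cos_le_one _)).congr (Eventually.of_forall fun p => ?_)
  simp only
  ring

lemma integrable_exp_mul_cosTransform (h : IsSpectralMeasure μ) (a : ℝ) {β : ℝ} (hβ : 0 < β)
    (D : ℝ) {Λ : ℝ} (hΛ : 0 ≤ Λ) {ψ : ℝ → ℝ} (hψ : ContinuousOn ψ (Icc 0 Λ)) :
    Integrable (fun x : ℝ => exp (-β * (x - a)) *
      (∫ τ in (0 : ℝ)..Λ, ψ τ * cos (τ * (x - D)))) μ := by
  have := h.isFiniteMeasureOnCompacts
  simp_rw [intervalIntegral.integral_of_le hΛ, ← integral_const_mul]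
  exact (h.integrable_prod_exp_mul_cos a hβ D hψ).integral_prod_left

/-- Smearing the Boltzmann weighted spectral measure with a function whose Fourier transform is
supported in `[-Λ, Λ]` only involves the partition function on a compact vertical segment. -/
lemma integral_exp_mul_cosTransform (h : IsSpectralMeasure μ) (c : ℝ) {β : ℝ} (hβ : 0 < β)
    (D : ℝ) {Λ : ℝ} (hΛ : 0 ≤ Λ) {ψ : ℝ → ℝ} (hψ : ContinuousOn ψ (Icc 0 Λ)) :
    ∫ x : ℝ, exp (-β * (x - c / 12)) * (∫ τ in (0 : ℝ)..Λ, ψ τ * cos (τ * (x - D))) ∂μ =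
      ∫ τ in (0 : ℝ)..Λ, ψ τ * (Complex.exp ((τ * (D - c / 12) : ℝ) * Complex.I) *
        partitionFunction c μ ((β : ℂ) + (τ : ℂ) * Complex.I)).re := by
  have := h.isFiniteMeasureOnCompacts
  simp_rw [intervalIntegral.integral_of_le hΛ, ← integral_const_mul]
  rw [integral_integral_swap]
  · congr 1
    ext τ
    have hi := (h.integrable_cexp_sub c (s := (β : ℂ) + (τ : ℂ) * Complex.I)
      (by simpa using hβ)).const_mul (Complex.exp ((τ * (D - c / 12) : ℝ) * Complex.I))
    have e := Complex.reCLM.integral_comp_comm hi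
    simp only [Complex.reCLM_apply] at e
    rw [partitionFunction, ← integral_const_mul, ← e, ← integral_const_mul]
    congr 1
    ext x
    rw [← Complex.exp_add]
    have : ((τ * (D - c / 12) : ℝ) : ℂ) * Complex.I +
        -((β : ℂ) + (τ : ℂ) * Complex.I) * ((x : ℂ) - (c : ℂ) / 12) =
        ((-β * (x - c / 12) : ℝ) : ℂ) + ((-(τ * (x - D)) : ℝ) : ℂ) * Complex.I := by
      push_cast; ring
    rw [this, Complex.exp_add, ← Complex.ofReal_exp, Complex.re_ofReal_mul,
      Complex.exp_ofReal_mul_I_re, cos_neg]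
    ring
  · exact h.integrable_prod_exp_mul_cos _ hβ D hψ

end IsSpectralMeasure

/-! ### Bounds from the modular transformation -/

section Modular

variable {N : ℕ} {c : ℝ} {F : Matrix (Fin (N + 1)) (Fin (N + 1)) ℂ} {μ : Fin (N + 1) → Measure ℝ}

lemma re_div_pos {s : ℂ} (hs : 0 < s.re) : 0 < (4 * (π : ℂ) ^ 2 / s).re := by
  have h0 : 0 < Complex.normSq s := Complex.normSq_pos.2 fun h => by simp [h] at hs
  have : (4 * (π : ℂ) ^ 2 / s) = ((4 * π ^ 2 : ℝ) : ℂ) * s⁻¹ := by push_cast; ring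
  rw [this, Complex.re_ofReal_mul, Complex.inv_re]
  have := pi_pos
  positivity

lemma IsVectorValuedModular.eq_sum (hZ : IsVectorValuedModular c F μ) (j : Fin (N + 1)) {s : ℂ}
    (hs : 0 < s.re) :
    partitionFunction c (μ j) s = ∑ k, F j k * partitionFunction c (μ k) (4 * (π : ℂ) ^ 2 / s) := by
  have h0 : s ≠ 0 := fun h => by simp [h] at hs
  have h := congrFun (hZ.modular _ (4 * (π : ℂ) ^ 2 / s).im (re_div_pos hs)) j
  rw [Complex.re_add_im] at h
  have hp : (π : ℂ) ≠ 0 := Complex.ofReal_ne_zero.2 pi_ne_zero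
  rw [show 4 * (π : ℂ) ^ 2 / (4 * (π : ℂ) ^ 2 / s) = s by field_simp] at h
  rw [h]
  rfl

/-- In the dual channel all dimensions are nonnegative, so growth is at most that of a state at
dimension 0. Summing over all entries of `F` gives one constant for all sectors. -/
lemma IsVectorValuedModular.exists_norm_le (hμ : ∀ j, IsSpectralMeasure (μ j))
    (hZ : IsVectorValuedModular c F μ) : ∃ C : ℝ, 0 ≤ C ∧ ∀ j (s : ℂ), 0 < s.re →
      1 ≤ (4 * (π : ℂ) ^ 2 / s).re →
      ‖partitionFunction c (μ j) s‖ ≤ C * exp ((4 * (π : ℂ) ^ 2 / s).re * (c / 12)) := by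
  have hl : ∀ k, 0 ≤ ∫ x : ℝ, exp (-1 * x) ∂(μ k) := fun k => integral_nonneg fun x => (exp_pos _).le
  have hn : ∀ i k, 0 ≤ ‖F i k‖ * ∫ x : ℝ, exp (-1 * x) ∂(μ k) := fun i k =>
    mul_nonneg (norm_nonneg _) (hl k)
  refine ⟨∑ i, ∑ k, ‖F i k‖ * ∫ x : ℝ, exp (-1 * x) ∂(μ k),
    Finset.sum_nonneg fun i _ => Finset.sum_nonneg fun k _ => hn i k, fun j s hs h1 => ?_⟩
  rw [hZ.eq_sum j hs]
  refine (norm_sum_le _ _).trans ?_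
  refine le_trans ?_ (mul_le_mul_of_nonneg_right (Finset.single_le_sum
    (f := fun i => ∑ k, ‖F i k‖ * ∫ x : ℝ, exp (-1 * x) ∂(μ k))
    (fun i _ => Finset.sum_nonneg fun k _ => hn i k) (Finset.mem_univ j)) (exp_pos _).le)
  rw [Finset.sum_mul]
  refine Finset.sum_le_sum fun k _ => ?_
  rw [norm_mul, mul_assoc]
  refine mul_le_mul_of_nonneg_left ?_ (norm_nonneg _)
  rw [mul_comm (∫ x : ℝ, exp (-1 * x) ∂(μ k))]
  exact ((hμ k).norm_partitionFunction_le c (re_div_pos hs)).trans ((hμ k).integral_exp_sub_le c h1)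

lemma four_pi_sq_div_re (β τ : ℝ) :
    (4 * (π : ℂ) ^ 2 / ((β : ℂ) + (τ : ℂ) * Complex.I)).re = 4 * π ^ 2 * β / (β ^ 2 + τ ^ 2) := by
  have : (4 * (π : ℂ) ^ 2 / ((β : ℂ) + (τ : ℂ) * Complex.I)) =
      ((4 * π ^ 2 : ℝ) : ℂ) * ((β : ℂ) + (τ : ℂ) * Complex.I)⁻¹ := by push_cast; ring
  rw [this, Complex.re_ofReal_mul, Complex.inv_re, Complex.normSq_add_mul_I]
  simp
  ring

/-- Away from the saddle point the partition functions are exponentially small compared with the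
vacuum contribution, as long as `|τ| ≤ Λ < 2π`. -/
lemma IsVectorValuedModular.exists_norm_le_tail (hμ : ∀ j, IsSpectralMeasure (μ j))
    (hZ : IsVectorValuedModular c F μ) {Λ : ℝ} :
    ∃ C : ℝ, 0 ≤ C ∧ ∀ j, ∀ β τ : ℝ, 0 < β → β ≤ 1 → β ≤ Λ ^ 2 → β ≤ τ → τ ≤ Λ →
      ‖partitionFunction c (μ j) ((β : ℂ) + (τ : ℂ) * Complex.I)‖ ≤
        C * (exp (π ^ 2 * c / 6 / β) + exp (c / 12 * (β + Λ ^ 2 / β))) := by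
  obtain ⟨C, hC, hb⟩ := hZ.exists_norm_le hμ
  have hp := pi_pos
  have hp3 := pi_gt_three
  have hl : ∀ k, 0 ≤ ∫ x : ℝ, exp (-1 * x) ∂(μ k) := fun k => integral_nonneg fun x => (exp_pos _).le
  have hls : 0 ≤ ∑ k, ∫ x : ℝ, exp (-1 * x) ∂(μ k) := Finset.sum_nonneg fun k _ => hl k
  have hFn : 0 ≤ ∑ i, ∑ k, ‖F i k‖ :=
    Finset.sum_nonneg fun i _ => Finset.sum_nonneg fun k _ => norm_nonneg _
  refine ⟨(∑ i, ∑ k, ‖F i k‖) * (C + ∑ k, ∫ x : ℝ, exp (-1 * x) ∂(μ k)), by positivity,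
    fun j β τ hβ hβ1 hβΛ hβτ hτΛ => ?_⟩
  have hτ : 0 < τ := hβ.trans_le hβτ
  have hΛ : 0 < Λ := hτ.trans_le hτΛ
  have hs : 0 < ((β : ℂ) + (τ : ℂ) * Complex.I).re := by simpa using hβ
  set u := (4 * (π : ℂ) ^ 2 / ((β : ℂ) + (τ : ℂ) * Complex.I)).re with hu
  have hu0 : 0 < u := re_div_pos hs
  rw [four_pi_sq_div_re] at hu
  -- `u₁` and `u₂` are the values of `u` at the ends `τ = Λ` and `τ = β` of the range.
  set u₁ := 4 * π ^ 2 * β / (β ^ 2 + Λ ^ 2) with hu1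
  set u₂ := 2 * π ^ 2 / β with hu2
  have hu10 : 0 < u₁ := by positivity
  have h1 : u₁ ≤ u := by
    rw [hu, hu1]
    gcongr
  have h2 : u ≤ u₂ := by
    rw [hu, hu2, div_le_div_iff₀ (by positivity) hβ]
    have : β ^ 2 ≤ τ ^ 2 := by gcongr
    nlinarith [mul_le_mul_of_nonneg_left this (by positivity : (0 : ℝ) ≤ 2 * π ^ 2)]
  have h21 : 1 ≤ u₂ := by
    rw [hu2, le_div_iff₀ hβ]
    nlinarith
  have hk : ∀ k, ‖partitionFunction c (μ k) (4 * (π : ℂ) ^ 2 / ((β : ℂ) + (τ : ℂ) * Complex.I))‖ ≤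
      (C + ∑ k, ∫ x : ℝ, exp (-1 * x) ∂(μ k)) *
        (exp (π ^ 2 * c / 6 / β) + exp (c / 12 * (β + Λ ^ 2 / β))) := fun k => by
    refine ((hμ k).norm_partitionFunction_le c hu0).trans
      (((hμ k).integral_exp_le_add (c / 12) hu10 h1 h2).trans ?_)
    have b2 := (hμ k).integral_exp_sub_le c h21
    have e2 : u₂ * (c / 12) = π ^ 2 * c / 6 / β := by rw [hu2]; field_simp; ring
    rw [e2] at b2
    have b3 : ∫ x : ℝ, exp (-1 * x) ∂(μ k) ≤ ∑ k, ∫ x : ℝ, exp (-1 * x) ∂(μ k) :=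
      Finset.single_le_sum (f := fun k => ∫ x : ℝ, exp (-1 * x) ∂(μ k)) (fun i _ => hl i)
        (Finset.mem_univ k)
    -- `u₁` may be small, where the dual integral is not directly controlled; a second modular
    -- transformation sends it to a point of real part at least 1, by `β ≤ Λ ^ 2`.
    have e1 : (4 * (π : ℂ) ^ 2 / (u₁ : ℂ)).re = β + Λ ^ 2 / β := by
      rw [show (4 * (π : ℂ) ^ 2 / (u₁ : ℂ)) = ((4 * π ^ 2 / u₁ : ℝ) : ℂ) by push_cast; ring,
        Complex.ofReal_re, hu1]
      field_simp
    have b1 := hb k u₁ (by simpa using hu10) (by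
      rw [e1]
      have : 1 ≤ Λ ^ 2 / β := by rwa [le_div_iff₀ hβ, one_mul]
      linarith)
    rw [e1, IsSpectralMeasure.partitionFunction_ofReal, Complex.norm_real, mul_comm _ (c / 12)] at b1
    have b1' := (le_abs_self _).trans b1
    have b4 := mul_le_mul_of_nonneg_left b3 (exp_pos (π ^ 2 * c / 6 / β)).le
    nlinarith [mul_nonneg hC (exp_pos (π ^ 2 * c / 6 / β)).le,
      mul_nonneg hls (exp_pos (c / 12 * (β + Λ ^ 2 / β))).le]
  rw [hZ.eq_sum j hs]
  refine (norm_sum_le _ _).trans ?_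
  rw [mul_assoc]
  refine le_trans ?_ (mul_le_mul_of_nonneg_right (Finset.single_le_sum
    (f := fun i => ∑ k, ‖F i k‖) (fun i _ => Finset.sum_nonneg fun k _ => norm_nonneg _)
    (Finset.mem_univ j)) (by positivity))
  rw [Finset.sum_mul]
  refine Finset.sum_le_sum fun k _ => ?_
  rw [norm_mul]
  exact mul_le_mul_of_nonneg_left (hk k) (norm_nonneg _)

end Modular

/-! ### Saddle point asymptotics -/

section Saddle

variable {N : ℕ} {c : ℝ} {F : Matrix (Fin (N + 1)) (Fin (N + 1)) ℂ} {μ : Fin (N + 1) → Measure ℝ}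

/-- The weighted partition function near the saddle point, with `β = b²`, `τ = b³ v` and
`Δ = π² c / (3 b⁴)`. -/
def saddleIntegrand (c : ℝ) (μ : Measure ℝ) (b v : ℝ) : ℂ :=
  Complex.exp (-(π ^ 2 * c / 3 / b ^ 2 : ℝ)) *
    (Complex.exp ((b ^ 3 * v * (π ^ 2 * c / 3 / b ^ 4 - c / 12) : ℝ) * Complex.I) *
      partitionFunction c μ (((b ^ 2 : ℝ) : ℂ) + ((b ^ 3 * v : ℝ) : ℂ) * Complex.I))

lemma one_add_mul_I_ne_zero (x : ℝ) : (1 : ℂ) + (x : ℂ) * Complex.I ≠ 0 := fun h => by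
  have := congrArg Complex.re h
  simp at this

/-- With `x = ibv` and `s = b²(1 + x)`, the singular exponents combine through `-1 + x + 1/(1 + x) =
x²/(1 + x)`: the linear terms cancel, which is why `Δ = π²c/(3b⁴)` is the saddle. -/
lemma IsVectorValuedModular.saddleIntegrand_eq (hZ : IsVectorValuedModular c F μ)
    (j : Fin (N + 1)) {b : ℝ} (hb : 0 < b) (v : ℝ) :
    saddleIntegrand c (μ j) b v = ∑ k, F j k *
      (Complex.exp (-((π ^ 2 * c / 3 * v ^ 2 : ℝ) : ℂ) / (1 + ((b * v : ℝ) : ℂ) * Complex.I) -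
        ((b ^ 3 * v * (c / 12) : ℝ) : ℂ) * Complex.I) *
      laplace (μ k) (4 * (π : ℂ) ^ 2 / (((b ^ 2 : ℝ) : ℂ) + ((b ^ 3 * v : ℝ) : ℂ) * Complex.I))) := by
  have hs : 0 < (((b ^ 2 : ℝ) : ℂ) + ((b ^ 3 * v : ℝ) : ℂ) * Complex.I).re := by
    simp only [Complex.add_re, Complex.ofReal_re, Complex.re_ofReal_mul, Complex.I_re, mul_zero,
      add_zero]
    positivity
  rw [saddleIntegrand, hZ.eq_sum j hs, Finset.mul_sum, Finset.mul_sum]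
  refine Finset.sum_congr rfl fun k _ => ?_
  rw [partitionFunction_eq]
  have hbc : (b : ℂ) ≠ 0 := Complex.ofReal_ne_zero.2 hb.ne'
  have h1 := one_add_mul_I_ne_zero (b * v)
  have e : (((b ^ 2 : ℝ) : ℂ) + ((b ^ 3 * v : ℝ) : ℂ) * Complex.I) =
      (b : ℂ) ^ 2 * (1 + ((b * v : ℝ) : ℂ) * Complex.I) := by push_cast; ring
  have key : -((π ^ 2 * c / 3 * v ^ 2 : ℝ) : ℂ) / (1 + ((b * v : ℝ) : ℂ) * Complex.I) -
        ((b ^ 3 * v * (c / 12) : ℝ) : ℂ) * Complex.I =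
      -(π ^ 2 * c / 3 / b ^ 2 : ℝ) +
      ((b ^ 3 * v * (π ^ 2 * c / 3 / b ^ 4 - c / 12) : ℝ) * Complex.I +
      4 * (π : ℂ) ^ 2 / (((b ^ 2 : ℝ) : ℂ) + ((b ^ 3 * v : ℝ) : ℂ) * Complex.I) * (c / 12)) := by
    rw [e]
    rw [mul_comm b v] at h1 ⊢
    push_cast at h1 ⊢
    field_simp
    ring_nf
    simp only [Complex.I_sq]
    ring
  rw [key, Complex.exp_add, Complex.exp_add]
  ring

lemma re_saddle (b v : ℝ) (hb : 0 < b) :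
    (4 * (π : ℂ) ^ 2 / (((b ^ 2 : ℝ) : ℂ) + ((b ^ 3 * v : ℝ) : ℂ) * Complex.I)).re =
      4 * π ^ 2 / (b ^ 2 * (1 + (b * v) ^ 2)) := by
  rw [four_pi_sq_div_re]
  field_simp

lemma IsVectorValuedModular.tendsto_saddleIntegrand (hμ : ∀ j, IsSpectralMeasure (μ j))
    (hZ : IsVectorValuedModular c F μ) (hvac : VacuumInFirstSector μ) (j : Fin (N + 1)) (v : ℝ) :
    Tendsto (fun b => saddleIntegrand c (μ j) b v) (𝓝[>] 0)
      (𝓝 (F j 0 * (exp (-(π ^ 2 * c / 3) * v ^ 2) : ℝ))) := by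
  have hid : Tendsto (fun b : ℝ => b) (𝓝[>] 0) (𝓝 0) := tendsto_nhdsWithin_of_tendsto_nhds tendsto_id
  have hlim : F j 0 * ((exp (-(π ^ 2 * c / 3) * v ^ 2) : ℝ) : ℂ) =
      ∑ k, F j k * (((exp (-(π ^ 2 * c / 3) * v ^ 2) : ℝ) : ℂ) * ((μ k).real {0} : ℂ)) := by
    rw [Finset.sum_eq_single 0]
    · simp [Measure.real, hvac.first]
    · intro k _ hk
      simp [Measure.real, hvac.other k hk]
    · simp
  rw [hlim]
  have hsum : Tendsto (fun b : ℝ => ∑ k, F j k *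
      (Complex.exp (-((π ^ 2 * c / 3 * v ^ 2 : ℝ) : ℂ) / (1 + ((b * v : ℝ) : ℂ) * Complex.I) -
        ((b ^ 3 * v * (c / 12) : ℝ) : ℂ) * Complex.I) *
      laplace (μ k) (4 * (π : ℂ) ^ 2 / (((b ^ 2 : ℝ) : ℂ) + ((b ^ 3 * v : ℝ) : ℂ) * Complex.I))))
      (𝓝[>] 0) (𝓝 (∑ k, F j k *
        (((exp (-(π ^ 2 * c / 3) * v ^ 2) : ℝ) : ℂ) * ((μ k).real {0} : ℂ)))) := by
    refine tendsto_finsetSum _ fun k _ => Tendsto.const_mul _ (Tendsto.mul ?_ ?_)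
    · have hc : Continuous fun b : ℝ =>
          Complex.exp (-((π ^ 2 * c / 3 * v ^ 2 : ℝ) : ℂ) / (1 + ((b * v : ℝ) : ℂ) * Complex.I) -
            ((b ^ 3 * v * (c / 12) : ℝ) : ℂ) * Complex.I) :=
        Complex.continuous_exp.comp (((continuous_const).div (by fun_prop)
          fun b => one_add_mul_I_ne_zero _).sub (by fun_prop))
      have := (hc.tendsto 0).comp hid
      simp only [Function.comp_def] at this
      convert this using 2
      rw [Complex.ofReal_exp]
      congr 1
      simp
    · refine (hμ k).tendsto_laplace ?_
      have h0 : Tendsto (fun b : ℝ => b ^ 2 * (1 + (b * v) ^ 2)) (𝓝[>] 0) (𝓝[>] 0) := by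
        refine tendsto_nhdsWithin_iff.2 ⟨?_, ?_⟩
        · have := ((by fun_prop : Continuous fun b : ℝ => b ^ 2 * (1 + (b * v) ^ 2)).tendsto 0).comp hid
          simpa [Function.comp_def] using this
        · filter_upwards [self_mem_nhdsWithin] with b hb
          have : (0 : ℝ) < b := hb
          simp only [mem_Ioi]
          positivity
      have h1 := (tendsto_inv_nhdsGT_zero.comp h0).const_mul_atTop
        (by have := pi_pos; positivity : 0 < 4 * π ^ 2)
      refine h1.congr' ?_
      filter_upwards [self_mem_nhdsWithin] with b hb
      rw [re_saddle b v hb]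
      rfl
  refine hsum.congr' ?_
  filter_upwards [self_mem_nhdsWithin] with b hb
  rw [hZ.saddleIntegrand_eq j hb]

lemma exp_neg_ofReal_norm (x : ℝ) : ‖Complex.exp (-(x : ℂ))‖ = exp (-x) := by
  rw [Complex.norm_exp]
  simp

lemma norm_saddleIntegrand (c : ℝ) (μ : Measure ℝ) (b v : ℝ) :
    ‖saddleIntegrand c μ b v‖ = exp (-(π ^ 2 * c / 3 / b ^ 2)) *
      ‖partitionFunction c μ (((b ^ 2 : ℝ) : ℂ) + ((b ^ 3 * v : ℝ) : ℂ) * Complex.I)‖ := by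
  rw [saddleIntegrand, norm_mul, norm_mul, exp_neg_ofReal_norm, Complex.norm_exp_ofReal_mul_I,
    one_mul]

/-- The range `v ≤ b⁻¹` means `τ ≤ β`, so `1 + (bv)² ≤ 2` and at least half of the Gaussian exponent
survives, uniformly in `b`. -/
lemma IsVectorValuedModular.exists_norm_saddleIntegrand_le (hc : 0 < c)
    (hμ : ∀ j, IsSpectralMeasure (μ j)) (hZ : IsVectorValuedModular c F μ) (j : Fin (N + 1)) :
    ∃ C : ℝ, 0 ≤ C ∧ ∀ b v : ℝ, 0 < b → b ≤ 1 → 0 ≤ v → v ≤ b⁻¹ →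
      ‖saddleIntegrand c (μ j) b v‖ ≤ C * exp (-(π ^ 2 * c / 6) * v ^ 2) := by
  obtain ⟨C, hC, h⟩ := hZ.exists_norm_le hμ
  refine ⟨C, hC, fun b v hb hb1 hv hvb => ?_⟩
  have hp := pi_gt_three
  have hbv : (b * v) ^ 2 ≤ 1 := by
    refine pow_le_one₀ (by positivity) ?_
    calc b * v ≤ b * b⁻¹ := by gcongr
      _ = 1 := mul_inv_cancel₀ hb.ne'
  have hs : 0 < (((b ^ 2 : ℝ) : ℂ) + ((b ^ 3 * v : ℝ) : ℂ) * Complex.I).re := by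
    simp only [Complex.add_re, Complex.ofReal_re, Complex.re_ofReal_mul, Complex.I_re, mul_zero,
      add_zero]
    positivity
  have hb2 : b ^ 2 ≤ 1 := pow_le_one₀ hb.le hb1
  have h1 := h j _ hs (by
    rw [re_saddle b v hb, le_div_iff₀ (by positivity)]
    nlinarith [sq_nonneg (b * v), sq_nonneg b])
  rw [re_saddle b v hb] at h1
  rw [norm_saddleIntegrand]
  refine (mul_le_mul_of_nonneg_left h1 (exp_pos _).le).trans ?_
  rw [mul_left_comm, ← exp_add]
  refine mul_le_mul_of_nonneg_left (exp_le_exp.2 ?_) hC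
  have e : -(π ^ 2 * c / 3 / b ^ 2) + 4 * π ^ 2 / (b ^ 2 * (1 + (b * v) ^ 2)) * (c / 12) =
      -(π ^ 2 * c / 3 * v ^ 2 / (1 + (b * v) ^ 2)) := by
    field_simp
    ring
  rw [e, neg_mul, neg_le_neg_iff, le_div_iff₀ (by positivity)]
  have : 0 ≤ π ^ 2 * c * v ^ 2 := by positivity
  nlinarith

lemma IsSpectralMeasure.continuous_saddleIntegrand {μ : Measure ℝ} (h : IsSpectralMeasure μ)
    (c : ℝ) {b : ℝ} (hb : 0 < b) : Continuous (saddleIntegrand c μ b) := by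
  have := (h.continuous_partitionFunction c (β := b ^ 2) (by positivity)).comp
    (by fun_prop : Continuous fun v : ℝ => b ^ 3 * v)
  unfold saddleIntegrand
  exact continuous_const.mul ((by fun_prop : Continuous _).mul this)

lemma IsVectorValuedModular.tendsto_integral_saddle (hc : 0 < c)
    (hμ : ∀ j, IsSpectralMeasure (μ j)) (hZ : IsVectorValuedModular c F μ)
    (hvac : VacuumInFirstSector μ) (j : Fin (N + 1)) {Λ : ℝ} (hΛ : 0 < Λ) {ψ : ℝ → ℝ}
    (hψ : ContinuousOn ψ (Icc 0 Λ)) :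
    Tendsto (fun b : ℝ => ∫ v in (0 : ℝ)..b⁻¹, ψ (b ^ 3 * v) * (saddleIntegrand c (μ j) b v).re)
      (𝓝[>] 0) (𝓝 ((F j 0).re * ψ 0 * (√(π / (π ^ 2 * c / 3)) / 2))) := by
  obtain ⟨M, hM⟩ := isCompact_Icc.exists_bound_of_continuousOn hψ
  obtain ⟨C, hC, hCb⟩ := hZ.exists_norm_saddleIntegrand_le hc hμ j
  have hid : Tendsto (fun b : ℝ => b) (𝓝[>] 0) (𝓝 0) := tendsto_nhdsWithin_of_tendsto_nhds tendsto_id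
  have hpos : ∀ᶠ b : ℝ in 𝓝[>] 0, 0 < b := self_mem_nhdsWithin
  have hsmall : ∀ r : ℝ, 0 < r → ∀ᶠ b : ℝ in 𝓝[>] 0, b < r := fun r hr => hid.eventually_lt_const hr
  have hM0 : 0 ≤ M := (norm_nonneg _).trans (hM 0 ⟨le_rfl, hΛ.le⟩)
  have hmem : ∀ b v : ℝ, 0 < b → b < 1 → b < Λ → v ∈ Ioc 0 b⁻¹ → b ^ 3 * v ∈ Icc 0 Λ := by
    intro b v hb h1 h2 hv
    refine ⟨by have := hv.1; positivity, ?_⟩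
    calc b ^ 3 * v ≤ b ^ 3 * b⁻¹ := by gcongr; exact hv.2
      _ = b * b := by field_simp
      _ ≤ 1 * Λ := by gcongr
      _ = Λ := one_mul _
  have e1 : (F j 0).re * ψ 0 * (√(π / (π ^ 2 * c / 3)) / 2) =
      ∫ v in Ioi (0 : ℝ), ψ 0 * (F j 0 * (exp (-(π ^ 2 * c / 3) * v ^ 2) : ℝ)).re := by
    rw [← integral_gaussian_Ioi, ← integral_const_mul]
    congr 1
    ext v
    rw [Complex.re_mul_ofReal]
    ring
  rw [e1]
  have hdom : Tendsto (fun b : ℝ => ∫ v in Ioi (0 : ℝ), indicator (Ioc 0 b⁻¹)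
      (fun v => ψ (b ^ 3 * v) * (saddleIntegrand c (μ j) b v).re) v) (𝓝[>] 0)
      (𝓝 (∫ v in Ioi (0 : ℝ), ψ 0 * (F j 0 * (exp (-(π ^ 2 * c / 3) * v ^ 2) : ℝ)).re)) := by
    refine tendsto_integral_filter_of_dominated_convergence
      (fun v => M * (C * exp (-(π ^ 2 * c / 6) * v ^ 2))) ?_ ?_ ?_ ?_
    · filter_upwards [hpos, hsmall 1 one_pos, hsmall Λ hΛ] with b hb hb1 hbΛ
      refine AEStronglyMeasurable.restrict ?_
      rw [aestronglyMeasurable_indicator_iff measurableSet_Ioc]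
      refine ContinuousOn.aestronglyMeasurable ?_ measurableSet_Ioc
      refine ContinuousOn.mul (hψ.comp (by fun_prop) fun v hv => hmem b v hb hb1 hbΛ hv) ?_
      exact (Complex.continuous_re.comp ((hμ j).continuous_saddleIntegrand c hb)).continuousOn
    · filter_upwards [hpos, hsmall 1 one_pos, hsmall Λ hΛ] with b hb hb1 hbΛ
      refine Eventually.of_forall fun v => ?_
      by_cases hv : v ∈ Ioc 0 b⁻¹
      · rw [indicator_of_mem hv, norm_mul]
        refine mul_le_mul (hM _ (hmem b v hb hb1 hbΛ hv)) ?_ (norm_nonneg _) hM0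
        exact (Complex.abs_re_le_norm _).trans (hCb b v hb hb1.le hv.1.le hv.2)
      · rw [indicator_of_notMem hv, norm_zero]
        positivity
    · exact (((integrable_exp_neg_mul_sq (by have := pi_pos; positivity)).const_mul C).const_mul
        M).integrableOn
    · refine (ae_restrict_iff' measurableSet_Ioi).2 (Eventually.of_forall fun v hv => ?_)
      have hv0 : 0 < v := hv
      have h1 : Tendsto (fun b : ℝ => b ^ 3 * v) (𝓝[>] 0) (𝓝 0) := by
        have := ((by fun_prop : Continuous fun b : ℝ => b ^ 3 * v).tendsto 0).comp hid
        simpa [Function.comp_def] using this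
      have hin : ∀ᶠ b : ℝ in 𝓝[>] 0, v ∈ Ioc 0 b⁻¹ := by
        filter_upwards [hpos, hsmall v⁻¹ (by positivity)] with b hb hbv
        exact ⟨hv0, by rw [le_inv_comm₀ hv0 hb]; exact hbv.le⟩
      have h2 : Tendsto (fun b : ℝ => ψ (b ^ 3 * v)) (𝓝[>] 0) (𝓝 (ψ 0)) := by
        have hcw : ContinuousWithinAt ψ (Icc 0 Λ) 0 := hψ 0 ⟨le_rfl, hΛ.le⟩
        refine hcw.tendsto.comp (tendsto_nhdsWithin_iff.2 ⟨h1, ?_⟩)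
        filter_upwards [hpos, hsmall 1 one_pos, hsmall Λ hΛ, hin] with b hb hb1 hbΛ hv
        exact hmem b v hb hb1 hbΛ hv
      have h3 := h2.mul ((Complex.continuous_re.tendsto _).comp
        (hZ.tendsto_saddleIntegrand hμ hvac j v))
      refine h3.congr' ?_
      filter_upwards [hin] with b hb
      rw [indicator_of_mem hb]
      rfl
  refine hdom.congr' ?_
  filter_upwards [hpos] with b hb
  rw [intervalIntegral.integral_of_le (by positivity), setIntegral_indicator measurableSet_Ioc,
    inter_eq_self_of_subset_right Ioc_subset_Ioi_self]

lemma tendsto_exp_neg_div_sq_div_cube {κ : ℝ} (hκ : 0 < κ) :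
    Tendsto (fun b : ℝ => exp (-κ / b ^ 2) / b ^ 3) (𝓝[>] 0) (𝓝 0) := by
  have h := tendsto_rpow_mul_exp_neg_mul_atTop_nhds_zero 3 κ hκ
  refine squeeze_zero' ?_ ?_ (h.comp tendsto_inv_nhdsGT_zero)
  · filter_upwards [self_mem_nhdsWithin] with b hb
    have : (0 : ℝ) < b := hb
    positivity
  · filter_upwards [Ioo_mem_nhdsGT one_pos] with b hb
    have hb0 : 0 < b := hb.1
    simp only [Function.comp]
    rw [div_eq_inv_mul, show (3 : ℝ) = ((3 : ℕ) : ℝ) by norm_num, rpow_natCast, inv_pow]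
    refine mul_le_mul_of_nonneg_left (exp_le_exp.2 ?_) (by positivity)
    rw [neg_div, neg_mul, neg_le_neg_iff, ← div_eq_mul_inv]
    refine div_le_div_of_nonneg_left hκ.le (by positivity) ?_
    nlinarith [hb.2]

/-- The smeared spectral density of sector `j` is governed by the vacuum in the dual channel. -/
theorem IsVectorValuedModular.tendsto_smeared (hc : 0 < c)
    (hμ : ∀ j, IsSpectralMeasure (μ j)) (hZ : IsVectorValuedModular c F μ)
    (hvac : VacuumInFirstSector μ) (j : Fin (N + 1)) {Λ : ℝ} (hΛ : 0 < Λ) (hΛ2 : Λ < 2 * π)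
    {ψ : ℝ → ℝ} (hψ : ContinuousOn ψ (Icc 0 Λ)) :
    Tendsto (fun b : ℝ => exp (-(π ^ 2 * c / 3 / b ^ 2)) / b ^ 3 *
        ∫ x : ℝ, exp (-b ^ 2 * (x - c / 12)) *
          (∫ τ in (0 : ℝ)..Λ, ψ τ * cos (τ * (x - π ^ 2 * c / 3 / b ^ 4))) ∂(μ j))
      (𝓝[>] 0) (𝓝 ((F j 0).re * ψ 0 * (√(π / (π ^ 2 * c / 3)) / 2))) := by
  obtain ⟨M, hM⟩ := isCompact_Icc.exists_bound_of_continuousOn hψ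
  have hM0 : 0 ≤ M := (norm_nonneg _).trans (hM 0 ⟨le_rfl, hΛ.le⟩)
  obtain ⟨C, hC, hCb⟩ := hZ.exists_norm_le_tail hμ (Λ := Λ)
  have hp := pi_pos
  have hid : Tendsto (fun b : ℝ => b) (𝓝[>] 0) (𝓝 0) := tendsto_nhdsWithin_of_tendsto_nhds tendsto_id
  have hpos : ∀ᶠ b : ℝ in 𝓝[>] 0, 0 < b := self_mem_nhdsWithin
  have hsmall : ∀ r : ℝ, 0 < r → ∀ᶠ b : ℝ in 𝓝[>] 0, b < r := fun r hr => hid.eventually_lt_const hr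
  set G : ℝ → ℝ → ℝ := fun b τ => ψ τ * (Complex.exp ((τ * (π ^ 2 * c / 3 / b ^ 4 - c / 12) : ℝ) *
    Complex.I) * partitionFunction c (μ j) (((b ^ 2 : ℝ) : ℂ) + (τ : ℂ) * Complex.I)).re with hG
  have hGc : ∀ b, 0 < b → ContinuousOn (G b) (Icc 0 Λ) := fun b hb =>
    hψ.mul (Complex.continuous_re.comp ((by fun_prop : Continuous _).mul
      ((hμ j).continuous_partitionFunction c (β := b ^ 2) (by positivity)))).continuousOn
  -- Both tail exponents stay strictly below the saddle exponent, by `π²c/6` and `c(4π² - Λ²)/12`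
  -- over `b²`; this beats the factor `b⁻³`.
  have htail : Tendsto (fun b : ℝ => exp (-(π ^ 2 * c / 3 / b ^ 2)) / b ^ 3 * ∫ τ in b ^ 2..Λ, G b τ)
      (𝓝[>] 0) (𝓝 0) := by
    have k1 := (tendsto_exp_neg_div_sq_div_cube (κ := π ^ 2 * c / 6) (by positivity)).const_mul
      (M * C * Λ)
    have k2 := (tendsto_exp_neg_div_sq_div_cube (κ := c / 12 * (4 * π ^ 2 - Λ ^ 2))
      (mul_pos (by positivity) (by nlinarith))).const_mul (M * C * Λ * exp (c / 12))
    have k3 := k1.add k2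
    simp only [mul_zero, add_zero] at k3
    refine squeeze_zero_norm' ?_ k3
    filter_upwards [hpos, hsmall 1 one_pos, hsmall Λ hΛ] with b hb hb1 hbΛ
    have hb2 : b ^ 2 ≤ 1 := pow_le_one₀ hb.le hb1.le
    have hb2Λ2 : b ^ 2 ≤ Λ ^ 2 := by gcongr
    have hb2Λ : b ^ 2 ≤ Λ := by nlinarith
    have hint : ‖∫ τ in b ^ 2..Λ, G b τ‖ ≤ M * (C * (exp (π ^ 2 * c / 6 / b ^ 2) +
        exp (c / 12 * (b ^ 2 + Λ ^ 2 / b ^ 2)))) * |Λ - b ^ 2| := by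
      refine intervalIntegral.norm_integral_le_of_norm_le_const fun τ hτ => ?_
      rw [uIoc_of_le hb2Λ] at hτ
      have hτ0 : 0 ≤ τ := le_trans (by positivity) hτ.1.le
      rw [hG, norm_mul]
      refine mul_le_mul (hM τ ⟨hτ0, hτ.2⟩) ?_ (norm_nonneg _) hM0
      refine (Complex.abs_re_le_norm _).trans ?_
      rw [norm_mul, Complex.norm_exp_ofReal_mul_I, one_mul]
      exact hCb j (b ^ 2) τ (by positivity) hb2 hb2Λ2 hτ.1.le hτ.2
    have habs : |Λ - b ^ 2| ≤ Λ := by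
      rw [abs_of_nonneg (by linarith)]
      nlinarith
    have hX : 0 ≤ exp (-(π ^ 2 * c / 3 / b ^ 2)) / b ^ 3 := by positivity
    rw [norm_mul, norm_of_nonneg hX]
    refine (mul_le_mul_of_nonneg_left (hint.trans
      (mul_le_mul_of_nonneg_left habs (by positivity))) hX).trans ?_
    have e1 : exp (-(π ^ 2 * c / 3 / b ^ 2)) * exp (π ^ 2 * c / 6 / b ^ 2) =
        exp (-(π ^ 2 * c / 6) / b ^ 2) := by
      rw [← exp_add]
      congr 1
      ring
    have e2 : exp (-(π ^ 2 * c / 3 / b ^ 2)) * exp (c / 12 * (b ^ 2 + Λ ^ 2 / b ^ 2)) ≤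
        exp (c / 12) * exp (-(c / 12 * (4 * π ^ 2 - Λ ^ 2)) / b ^ 2) := by
      rw [← exp_add, ← exp_add]
      refine exp_le_exp.2 ?_
      have : c / 12 * b ^ 2 ≤ c / 12 := by nlinarith
      have e3 : -(π ^ 2 * c / 3 / b ^ 2) + c / 12 * (b ^ 2 + Λ ^ 2 / b ^ 2) =
        c / 12 * b ^ 2 + -(c / 12 * (4 * π ^ 2 - Λ ^ 2)) / b ^ 2 := by ring
      rw [e3]
      linarith
    calc exp (-(π ^ 2 * c / 3 / b ^ 2)) / b ^ 3 * (M * (C * (exp (π ^ 2 * c / 6 / b ^ 2) +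
          exp (c / 12 * (b ^ 2 + Λ ^ 2 / b ^ 2)))) * Λ)
        = M * C * Λ / b ^ 3 * (exp (-(π ^ 2 * c / 3 / b ^ 2)) * exp (π ^ 2 * c / 6 / b ^ 2) +
          exp (-(π ^ 2 * c / 3 / b ^ 2)) * exp (c / 12 * (b ^ 2 + Λ ^ 2 / b ^ 2))) := by ring
      _ ≤ M * C * Λ / b ^ 3 * (exp (-(π ^ 2 * c / 6) / b ^ 2) +
          exp (c / 12) * exp (-(c / 12 * (4 * π ^ 2 - Λ ^ 2)) / b ^ 2)) := by
        rw [e1]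
        gcongr
      _ = _ := by ring
  have hmain := (hZ.tendsto_integral_saddle hc hμ hvac j hΛ hψ).add htail
  rw [add_zero] at hmain
  refine hmain.congr' ?_
  filter_upwards [hpos, hsmall 1 one_pos, hsmall Λ hΛ] with b hb hb1 hbΛ
  have hb2Λ : b ^ 2 ≤ Λ := by nlinarith
  have hfub := (hμ j).integral_exp_mul_cosTransform c (β := b ^ 2) (by positivity)
    (π ^ 2 * c / 3 / b ^ 4) hΛ.le hψ
  rw [hfub]
  have hi1 : IntervalIntegrable (G b) volume 0 (b ^ 2) := by
    refine ((hGc b hb).mono ?_).intervalIntegrable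
    rw [uIcc_of_le (by positivity)]
    exact Icc_subset_Icc_right hb2Λ
  have hi2 : IntervalIntegrable (G b) volume (b ^ 2) Λ := by
    refine ((hGc b hb).mono ?_).intervalIntegrable
    rw [uIcc_of_le hb2Λ]
    exact Icc_subset_Icc_left (by positivity)
  change _ = _ * ∫ τ in (0 : ℝ)..Λ, G b τ
  rw [← intervalIntegral.integral_add_adjacent_intervals hi1 hi2, mul_add]
  congr 1
  -- The substitution `τ = b³v` carries `[0, b⁻¹]` to `[0, b²]` and absorbs the factor `b⁻³`.
  have hsub := intervalIntegral.integral_comp_mul_left (a := 0) (b := b⁻¹) (G b)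
    (pow_ne_zero 3 hb.ne')
  rw [mul_zero, show b ^ 3 * b⁻¹ = b ^ 2 by field_simp, smul_eq_mul] at hsub
  rw [div_eq_mul_inv, mul_assoc, ← hsub, ← intervalIntegral.integral_const_mul]
  refine intervalIntegral.integral_congr fun v _ => ?_
  simp only [hG, saddleIntegrand]
  rw [← Complex.ofReal_neg, ← Complex.ofReal_exp, Complex.re_ofReal_mul]
  ring

/-- The first column of the modular matrix is real. -/
lemma IsVectorValuedModular.im_eq_zero (hμ : ∀ j, IsSpectralMeasure (μ j))
    (hZ : IsVectorValuedModular c F μ) (hvac : VacuumInFirstSector μ) (j : Fin (N + 1)) :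
    (F j 0).im = 0 := by
  -- At `v = 0` the Gaussian is 1 and the partition function is taken at a real point, so the entry
  -- is a limit of reals.
  have h := (Complex.continuous_im.tendsto _).comp (hZ.tendsto_saddleIntegrand hμ hvac j 0)
  have h0 : ∀ b, (saddleIntegrand c (μ j) b 0).im = 0 := fun b => by
    simp only [saddleIntegrand, mul_zero, zero_mul, Complex.ofReal_zero, Complex.exp_zero, one_mul,
      add_zero]
    rw [IsSpectralMeasure.partitionFunction_ofReal, ← Complex.ofReal_neg, ← Complex.ofReal_exp,
      ← Complex.ofReal_mul, Complex.ofReal_im]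
  have h1 := tendsto_nhds_unique h (tendsto_const_nhds.congr fun b => (h0 b).symm)
  simpa using h1

end Saddle

/-! ### Tauberian bounds for window averages -/

namespace IsSpectralMeasure

variable {μ : Measure ℝ} {Λ β : ℝ} {ψ : ℝ → ℝ} {δ : ℝ}

lemma integral_indicator_window (μ : Measure ℝ) (D δ : ℝ) :
    μ.real (Icc (D - δ) (D + δ)) = ∫ x, indicator (Icc (-δ) δ) (1 : ℝ → ℝ) (x - D) ∂μ := by
  rw [← integral_indicator_one measurableSet_Icc]
  congr 1
  ext x
  simp only [indicator, mem_Icc]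
  congr 1
  exact propext ⟨fun h => ⟨by linarith [h.1], by linarith [h.2]⟩,
    fun h => ⟨by linarith [h.1], by linarith [h.2]⟩⟩

lemma integrable_indicator_window (h : IsSpectralMeasure μ) (D δ : ℝ) :
    Integrable (fun x => indicator (Icc (-δ) δ) (1 : ℝ → ℝ) (x - D)) μ := by
  have := h.isFiniteMeasureOnCompacts
  have h1 : Integrable (indicator (Icc (D - δ) (D + δ)) (1 : ℝ → ℝ)) μ :=
    (integrable_indicator_iff measurableSet_Icc).2
      (integrableOn_const isCompact_Icc.measure_lt_top.ne)
  refine h1.congr (Eventually.of_forall fun x => ?_)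
  simp only [indicator, mem_Icc]
  congr 1
  exact propext ⟨fun h => ⟨by linarith [h.1], by linarith [h.2]⟩,
    fun h => ⟨by linarith [h.1], by linarith [h.2]⟩⟩

/-- The Boltzmann weight is normalized at the right end of the window, so it is at least 1 inside;
outside, the majorant is nonnegative. The minorant uses the left end instead. -/
lemma measure_window_le (h : IsSpectralMeasure μ) (a : ℝ) (hβ : 0 < β) (D : ℝ) (hΛ : 0 ≤ Λ)
    (hψ : ContinuousOn ψ (Icc 0 Λ))
    (hmaj : ∀ x, indicator (Icc (-δ) δ) 1 x ≤ ∫ τ in (0 : ℝ)..Λ, ψ τ * cos (τ * x)) :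
    μ.real (Icc (D - δ) (D + δ)) ≤ exp (β * (D + δ - a)) *
      ∫ x : ℝ, exp (-β * (x - a)) * (∫ τ in (0 : ℝ)..Λ, ψ τ * cos (τ * (x - D))) ∂μ := by
  rw [integral_indicator_window, ← integral_const_mul]
  refine integral_mono (h.integrable_indicator_window D δ)
    ((h.integrable_exp_mul_cosTransform a hβ D hΛ hψ).const_mul _) fun x => ?_
  simp only
  rw [← mul_assoc, ← exp_add]
  have h1 := hmaj (x - D)
  by_cases hx : x - D ∈ Icc (-δ) δ
  · rw [indicator_of_mem hx, Pi.one_apply] at *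
    have : 1 ≤ exp (β * (D + δ - a) + -β * (x - a)) := one_le_exp (by nlinarith [hx.2])
    nlinarith
  · rw [indicator_of_notMem hx] at *
    exact mul_nonneg (exp_pos _).le h1

lemma le_measure_window (h : IsSpectralMeasure μ) (a : ℝ) (hβ : 0 < β) (D : ℝ) (hΛ : 0 ≤ Λ)
    (hψ : ContinuousOn ψ (Icc 0 Λ))
    (hmin : ∀ x, ∫ τ in (0 : ℝ)..Λ, ψ τ * cos (τ * x) ≤ indicator (Icc (-δ) δ) 1 x) :
    exp (β * (D - δ - a)) *
      ∫ x : ℝ, exp (-β * (x - a)) * (∫ τ in (0 : ℝ)..Λ, ψ τ * cos (τ * (x - D))) ∂μ ≤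
      μ.real (Icc (D - δ) (D + δ)) := by
  rw [integral_indicator_window, ← integral_const_mul]
  refine integral_mono ((h.integrable_exp_mul_cosTransform a hβ D hΛ hψ).const_mul _)
    (h.integrable_indicator_window D δ) fun x => ?_
  simp only
  rw [← mul_assoc, ← exp_add]
  have h1 := hmin (x - D)
  have hE := exp_pos (β * (D - δ - a) + -β * (x - a))
  by_cases hx : x - D ∈ Icc (-δ) δ
  · rw [indicator_of_mem hx, Pi.one_apply] at *
    have : exp (β * (D - δ - a) + -β * (x - a)) ≤ 1 := exp_le_one_iff.2 (by nlinarith [hx.1])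
    nlinarith
  · rw [indicator_of_notMem hx] at *
    exact mul_nonpos_of_nonneg_of_nonpos hE.le h1

end IsSpectralMeasure

/-- The cosine transform of Selberg's functions for the interval `[-δ, δ]`, with support rescaled
to `[0, 2πl]`. -/
def selbergScaled (σ δ l τ : ℝ) : ℝ := selbergHat σ (l * δ) (τ / (2 * π * l)) / (π * l)

section Scaled

variable {δ l : ℝ}

lemma continuousOn_selbergScaled (σ δ : ℝ) (hl : 0 < l) :
    ContinuousOn (selbergScaled σ δ l) (Icc 0 (2 * π * l)) := by
  have hp := pi_pos
  refine ContinuousOn.div_const ((continuousOn_selbergHat σ (l * δ)).comp (by fun_prop) ?_) _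
  intro τ hτ
  exact ⟨div_nonneg hτ.1 (by positivity), div_le_one_of_le₀ hτ.2 (by positivity)⟩

lemma selbergScaled_zero (σ δ : ℝ) (hl : 0 < l) :
    selbergScaled σ δ l 0 = (2 * δ + σ / l) / π := by
  have hp := pi_pos
  rw [selbergScaled, zero_div, selbergHat_zero]
  field_simp

lemma integral_selbergScaled (σ δ : ℝ) (hl : 0 < l) (x : ℝ) :
    ∫ τ in (0 : ℝ)..2 * π * l, selbergScaled σ δ l τ * cos (τ * x) =
      2 * ∫ t in (0 : ℝ)..1, selbergHat σ (l * δ) t * cos (2 * π * t * (l * x)) := by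
  have hp := pi_pos
  have hL : 2 * π * l ≠ 0 := by positivity
  have h := intervalIntegral.integral_comp_div (a := 0) (b := 2 * π * l)
    (fun t => selbergHat σ (l * δ) t * cos (2 * π * t * (l * x))) hL
  rw [zero_div, div_self hL, smul_eq_mul] at h
  have h2 : (2 : ℝ) * ∫ t in (0 : ℝ)..1, selbergHat σ (l * δ) t * cos (2 * π * t * (l * x)) =
      (1 / (π * l)) * (2 * π * l * ∫ t in (0 : ℝ)..1,
        selbergHat σ (l * δ) t * cos (2 * π * t * (l * x))) := by
    rw [← mul_assoc]
    congr 1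
    field_simp
  rw [h2, ← h, ← intervalIntegral.integral_const_mul]
  refine intervalIntegral.integral_congr fun τ _ => ?_
  simp only [selbergScaled]
  rw [show 2 * π * (τ / (2 * π * l)) * (l * x) = τ * x by field_simp]
  ring

lemma indicator_Icc_scale (hl : 0 < l) (x : ℝ) :
    indicator (Icc (-(l * δ)) (l * δ)) (1 : ℝ → ℝ) (l * x) = indicator (Icc (-δ) δ) 1 x := by
  simp only [indicator, mem_Icc, ← mul_neg, mul_le_mul_iff_right₀ hl, Pi.one_apply]

end Scaled

/-- Half of the exponent matches `exp (βΔ)` and half the dual vacuum; the last factor is the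
Gaussian integral over `π`. The prefactors are compared through their fourth powers. -/
lemma rhoZero_saddle {c b : ℝ} (hc : 0 < c) (hb : 0 < b) :
    rhoZero c (π ^ 2 * c / 3 / b ^ 4) =
      exp (2 * (π ^ 2 * c / 3 / b ^ 2)) * b ^ 3 * (√(π / (π ^ 2 * c / 3)) / 2 / π) := by
  have hp := pi_pos
  rw [rhoZero, mul_comm (_ ^ (1 / 4 : ℝ)), mul_assoc (exp _)]
  refine congrArg₂ (· * ·) ?_ ?_
  · congr 1
    have : c * (π ^ 2 * c / 3 / b ^ 4) / 3 = (π * c / 3 / b ^ 2) ^ 2 := by field_simp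
    rw [this, sqrt_sq (by positivity)]
    ring
  · have h4 : c / (48 * (π ^ 2 * c / 3 / b ^ 4) ^ 3) =
        (b ^ 3 * (√(π / (π ^ 2 * c / 3)) / 2 / π)) ^ 4 := by
      have hs : √(π / (π ^ 2 * c / 3)) ^ 4 = (π / (π ^ 2 * c / 3)) ^ 2 := by
        rw [show (4 : ℕ) = 2 * 2 by norm_num, pow_mul, sq_sqrt (by positivity)]
      rw [mul_pow, div_pow (_ / 2), div_pow (√_), hs]
      field_simp
      norm_num
    rw [h4, ← rpow_natCast, ← rpow_mul (by positivity)]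
    norm_num

/-! ### Comparison with the Cardy density and passage to large dimensions -/

section Tauberian

variable {N : ℕ} {c : ℝ} {F : Matrix (Fin (N + 1)) (Fin (N + 1)) ℂ} {μ : Fin (N + 1) → Measure ℝ}

/-- The smeared density for Selberg's function, relative to the Cardy density. -/
def smearedRatio (c : ℝ) (μ : Measure ℝ) (σ δ l b : ℝ) : ℝ :=
  1 / (2 * δ) * (exp (b ^ 2 * (π ^ 2 * c / 3 / b ^ 4 + σ * δ - c / 12)) *
    ∫ x : ℝ, exp (-b ^ 2 * (x - c / 12)) * (∫ τ in (0 : ℝ)..2 * π * l, selbergScaled σ δ l τ *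
      cos (τ * (x - π ^ 2 * c / 3 / b ^ 4))) ∂μ) / rhoZero c (π ^ 2 * c / 3 / b ^ 4)

lemma IsVectorValuedModular.tendsto_smearedRatio (hc : 0 < c)
    (hμ : ∀ j, IsSpectralMeasure (μ j)) (hZ : IsVectorValuedModular c F μ)
    (hvac : VacuumInFirstSector μ) (j : Fin (N + 1)) (σ : ℝ) {δ l : ℝ} (hδ : 0 < δ) (hl : 0 < l)
    (hl1 : l < 1) :
    Tendsto (smearedRatio c (μ j) σ δ l) (𝓝[>] 0)
      (𝓝 ((1 + σ * (1 / (2 * δ)) / l) * (F j 0).re)) := by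
  have hp := pi_pos
  have h := hZ.tendsto_smeared hc hμ hvac j (Λ := 2 * π * l) (by positivity) (by nlinarith)
    (continuousOn_selbergScaled σ δ hl)
  rw [selbergScaled_zero σ δ hl] at h
  set K := √(π / (π ^ 2 * c / 3)) / 2 with hK
  have hK0 : 0 < K := by positivity
  have he : Tendsto (fun b : ℝ => exp (b ^ 2 * (σ * δ - c / 12))) (𝓝[>] 0) (𝓝 1) := by
    have := ((by fun_prop : Continuous fun b : ℝ => exp (b ^ 2 * (σ * δ - c / 12))).tendsto 0)
    simp only [ne_eq, OfNat.ofNat_ne_zero, not_false_eq_true, zero_pow, zero_mul, exp_zero] at this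
    exact tendsto_nhdsWithin_of_tendsto_nhds this
  have h2 := (he.mul h).mul_const (1 / (2 * δ) / (K / π))
  have e : 1 * ((F j 0).re * ((2 * δ + σ / l) / π) * K) * (1 / (2 * δ) / (K / π)) =
      (1 + σ * (1 / (2 * δ)) / l) * (F j 0).re := by
    field_simp
  rw [e] at h2
  refine h2.congr' ?_
  filter_upwards [self_mem_nhdsWithin] with b hb
  have hb0 : 0 < b := hb
  rw [smearedRatio, rhoZero_saddle hc hb0, ← hK]
  have e1 : exp (b ^ 2 * (π ^ 2 * c / 3 / b ^ 4 + σ * δ - c / 12)) =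
      exp (b ^ 2 * (σ * δ - c / 12)) * exp (π ^ 2 * c / 3 / b ^ 2) := by
    rw [← exp_add]
    congr 1
    field_simp
    ring
  have e2 : exp (2 * (π ^ 2 * c / 3 / b ^ 2)) = exp (π ^ 2 * c / 3 / b ^ 2) ^ 2 := by
    rw [← exp_nat_mul]
    norm_num
  rw [e1, e2, exp_neg]
  have := exp_pos (π ^ 2 * c / 3 / b ^ 2)
  field_simp

lemma tendsto_add_div_nhdsLT_one (a d r : ℝ) :
    Tendsto (fun l : ℝ => (a + d / l) * r) (𝓝[<] 1) (𝓝 ((a + d) * r)) := by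
  have h : ContinuousAt (fun l : ℝ => (a + d / l) * r) 1 := by
    refine ContinuousAt.mul (ContinuousAt.add continuousAt_const
      (continuousAt_const.div continuousAt_id one_ne_zero)) continuousAt_const
  have := h.tendsto
  rw [div_one] at this
  exact tendsto_nhdsWithin_of_tendsto_nhds this

lemma IsVectorValuedModular.eventually_windowAverage_le (hc : 0 < c)
    (hμ : ∀ j, IsSpectralMeasure (μ j)) (hZ : IsVectorValuedModular c F μ)
    (hvac : VacuumInFirstSector μ) (j : Fin (N + 1)) {δ ε : ℝ} (hδ : 0 < δ) (hε : 0 < ε) :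
    ∀ᶠ b : ℝ in 𝓝[>] 0, windowAverage (μ j) δ (π ^ 2 * c / 3 / b ^ 4) ≤
      ((1 + 1 / (2 * δ)) * (F j 0).re + ε) * rhoZero c (π ^ 2 * c / 3 / b ^ 4) := by
  have hp := pi_pos
  -- The band limit `2πl` must be strictly below `2π`; the loss from `l < 1` is absorbed in `ε`.
  obtain ⟨l, hlt, hl0, hl1⟩ := (((tendsto_add_div_nhdsLT_one 1 (1 / (2 * δ))
    (F j 0).re).eventually_lt_const (lt_add_of_pos_right _ hε)).and
    (Ioo_mem_nhdsLT one_pos)).exists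
  have h := hZ.tendsto_smearedRatio hc hμ hvac j 1 hδ hl0 hl1
  rw [one_mul] at h
  filter_upwards [h.eventually_lt_const hlt, self_mem_nhdsWithin] with b hb hb0
  have hb0 : 0 < b := hb0
  have hρ : 0 < rhoZero c (π ^ 2 * c / 3 / b ^ 4) := by
    rw [rhoZero_saddle hc hb0]
    positivity
  rw [smearedRatio, div_lt_iff₀ hρ] at hb
  refine le_trans ?_ hb.le
  rw [windowAverage]
  refine mul_le_mul_of_nonneg_left ?_ (by positivity)
  rw [one_mul]
  refine (hμ j).measure_window_le (c / 12) (by positivity) _ (by positivity)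
    (continuousOn_selbergScaled 1 δ hl0) fun x => ?_
  rw [integral_selbergScaled 1 δ hl0, ← indicator_Icc_scale hl0]
  exact indicator_le_integral_selbergHat (by positivity) _

lemma IsVectorValuedModular.eventually_le_windowAverage (hc : 0 < c)
    (hμ : ∀ j, IsSpectralMeasure (μ j)) (hZ : IsVectorValuedModular c F μ)
    (hvac : VacuumInFirstSector μ) (j : Fin (N + 1)) {δ ε : ℝ} (hδ : 0 < δ) (hε : 0 < ε) :
    ∀ᶠ b : ℝ in 𝓝[>] 0, ((1 - 1 / (2 * δ)) * (F j 0).re - ε) *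
      rhoZero c (π ^ 2 * c / 3 / b ^ 4) ≤ windowAverage (μ j) δ (π ^ 2 * c / 3 / b ^ 4) := by
  have hp := pi_pos
  obtain ⟨l, hlt, hl0, hl1⟩ := (((tendsto_add_div_nhdsLT_one 1 (-1 * (1 / (2 * δ)))
    (F j 0).re).eventually_const_lt (sub_lt_self _ hε)).and
    (Ioo_mem_nhdsLT one_pos)).exists
  have h := hZ.tendsto_smearedRatio hc hμ hvac j (-1) hδ hl0 hl1
  filter_upwards [h.eventually_const_lt hlt, self_mem_nhdsWithin] with b hb hb0
  have hb0 : 0 < b := hb0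
  have hρ : 0 < rhoZero c (π ^ 2 * c / 3 / b ^ 4) := by
    rw [rhoZero_saddle hc hb0]
    positivity
  rw [smearedRatio, lt_div_iff₀ hρ, neg_one_mul, ← sub_eq_add_neg] at hb
  refine le_trans hb.le ?_
  rw [windowAverage]
  refine mul_le_mul_of_nonneg_left ?_ (by positivity)
  rw [neg_one_mul, ← sub_eq_add_neg]
  refine (hμ j).le_measure_window (c / 12) (by positivity) _ (by positivity)
    (continuousOn_selbergScaled (-1) δ hl0) fun x => ?_
  rw [integral_selbergScaled (-1) δ hl0, ← indicator_Icc_scale hl0]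
  exact integral_selbergHat_le_indicator _ _

/-- Every large `D` equals `A / b⁴` with `b` the fourth root of `A / D`, and this `b` tends to 0
from the right. -/
lemma eventually_atTop_of_saddle {A : ℝ} (hA : 0 < A) {p : ℝ → Prop}
    (h : ∀ᶠ b : ℝ in 𝓝[>] 0, p (A / b ^ 4)) : ∀ᶠ D : ℝ in atTop, p D := by
  have h1 : Tendsto (fun D : ℝ => √(√(A / D))) atTop (𝓝[>] 0) := by
    refine tendsto_nhdsWithin_iff.2 ⟨?_, ?_⟩
    · have := ((continuous_sqrt.comp continuous_sqrt).tendsto 0).comp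
        ((tendsto_const_nhds (x := A)).div_atTop tendsto_id)
      simpa [Function.comp_def] using this
    · filter_upwards [eventually_gt_atTop 0] with D hD
      simp only [mem_Ioi]
      positivity
  filter_upwards [h1.eventually h, eventually_gt_atTop 0] with D hD hD0
  have e : √(√(A / D)) ^ 4 = A / D := by
    rw [show (4 : ℕ) = 2 * 2 by norm_num, pow_mul, sq_sqrt (by positivity),
      sq_sqrt (by positivity)]
  rwa [e, div_div_cancel₀ hA.ne'] at hD

end Tauberian

end VVMF

end

theorem theorem5p1 {N : ℕ} (c : ℝ) (hc : 0 < c)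
    (F : Matrix (Fin (N + 1)) (Fin (N + 1)) ℂ) (μ : Fin (N + 1) → Measure ℝ)
    (hμ : ∀ j, VVMF.IsSpectralMeasure (μ j))
    (hZ : VVMF.IsVectorValuedModular c F μ)
    (hvac : VVMF.VacuumInFirstSector μ)
    (δ : ℝ) (hδ : 0 < δ) (j : Fin (N + 1)) :
    (F j 0).im = 0 ∧
    ∀ ε : ℝ, 0 < ε → ∀ᶠ Δ : ℝ in atTop,
      ((1 - 1 / (2 * δ)) * (F j 0).re - ε) * VVMF.rhoZero c Δ ≤ VVMF.windowAverage (μ j) δ Δ ∧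
      VVMF.windowAverage (μ j) δ Δ ≤ ((1 + 1 / (2 * δ)) * (F j 0).re + ε) * VVMF.rhoZero c Δ := by
  have hA : 0 < Real.pi ^ 2 * c / 3 := by have := Real.pi_pos; positivity
  exact ⟨hZ.im_eq_zero hμ hvac j, fun ε hε =>
    (VVMF.eventually_atTop_of_saddle hA (hZ.eventually_le_windowAverage hc hμ hvac j hδ hε)).and
      (VVMF.eventually_atTop_of_saddle hA (hZ.eventually_windowAverage_le hc hμ hvac j hδ hε))⟩
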